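/- **Setting.** Fix $d\ge 1$, $\gamma\in(1,\infty]$, $\tau\in(2,3)$, $C,w_0>0$, and put $\mu=w_0\frac{\tau-1}{\tau-2}$ and $C_1=(1+(\gamma-1)^{-1})2^d$ (with $1/\infty=0$). For every $n$ let $V=[n]$, let $V_C=\{1,\dots,k\}$ with $k=k(n)\le n$, and let $w_1,\dots,w_n>0$ be deterministic weights (which may depend on $n$). Let $F_n(x)=\frac1n\#\{i\in V: w_i\le x\}$ and $F_k(x)=\frac1k\#\{i\in V_C: w_i\le x\}$. As $n\to\infty$, assume that 1. $1-F_n(x)=Cx^{1-\tau}(1+o(1))$ uniformly over $w_0\le x\le n^{1/(\tau-1)}/\log n$; 2. $1-F_k(x)=Cx^{1-\tau}(1+o(1))$ uniformly over $w_0\le x\le A\,k^{1/(\tau-1)}/\log k$, for every constant $A>0$; 3. the vertices beyond the range of (1) have total weight $\sum_{i:\,w_i>n^{1/(\tau-1)}/\log n}w_i=O(n)$. Under $H_0$, the edges $\{i,j\}$ of the random simple graph $G$ on $V$ are present independently with probabilities $\min\left(\frac{w_iw_j}{\mu n},1\right)$. Under $H_1$, the vertices $i\in V_C$ have independent uniform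 positions $x_i$ in the torus $(\mathbb R/\mathbb Z)^d$, with $\|x-y\|$ the maximum over the coordinates of the circle distance $\min_{m\in\mathbb Z}|x(l)-y(l)-m|$. Given the positions, the edges are present independently, with probability $\frac{1}{1+C_1}\min\left(\frac{w_iw_j}{\mu k\|x_i-x_j\|^d},1\right)^{\gamma}$ if $i,j\in V_C$, and with probability $\frac1{1+C_1}\min\left(\frac{w_iw_j}{\mu n},1\right)$ otherwise. For $\gamma=\infty$ the first of these is read as $\frac1{1+C_1}$ if $\|x_i-x_j\|^d\le \frac{w_iw_j}{\mu k}$, and $0$ otherwise. Write $P_0,P_1$ for the probabilities under $H_0,H_1$. **Theorem 3.1.** Let $f(n)\to\infty$ with $f(n)=o(k(n))$ as $n\to\infty$. Let $$W(G)=\sum_{a,b,c\in V}\frac{1}{w_aw_bw_c}\mathbf 1\{a,b,c\text{ form a triangle in }G\}$$ (a sum over ordered triples). The weighted triangle test, which rejects $H_0$ if and only if $W(G)\ge f(n)$, is asymptotically powerful, that is, $$\lim_{n\to\infty}\Big(P_0\big(W(G)\ge f(n)\big)+P_1\big(W(G)<f(n)\big)\Big)=0 .$$ -/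

import Mathlib

open Filter Topology MeasureTheory Asymptotics
open scoped ENNReal

noncomputable section

namespace GeoCommunity

/-! ### Weight sequences -/

/-- The proportion of indices in `S` whose weight is at most `x` (empirical distribution function
of the weights in `S`). -/
def empiricalCDF {n : ℕ} (w : Fin n → ℝ) (S : Finset (Fin n)) (x : ℝ) : ℝ :=
  ((S.filter fun i => w i ≤ x).card : ℝ) / (S.card : ℝ)

/-- The community `V_C`, consisting of the first `k` of the `n` vertices. -/
def community (n k : ℕ) : Finset (Fin n) := Finset.univ.filter fun i => i.val < k

/-- The natural cutoff `m ^ (1 / (τ - 1)) / log m` for `m` power-law weights. -/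
def cutoff (τ : ℝ) (m : ℕ) : ℝ := (m : ℝ) ^ (1 / (τ - 1)) / Real.log (m : ℝ)

/-- `1 - F_n(x) = C x ^ (1 - τ) (1 + o(1))` as `n → ∞`, uniformly over `w₀ ≤ x ≤ b n`. -/
def HasPowerLawTail (τ C w₀ : ℝ) (F : ℕ → ℝ → ℝ) (b : ℕ → ℝ) : Prop :=
  ∀ ε : ℝ, 0 < ε → ∀ᶠ n in atTop, ∀ x : ℝ, w₀ ≤ x → x ≤ b n →
    |(1 - F n x) - C * x ^ (1 - τ)| ≤ ε * (C * x ^ (1 - τ))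

/-- The weights of all `n` vertices have a power-law tail, for `w₀ ≤ x ≤ n^(1/(τ-1)) / log n`. -/
def PowerLawWeights (τ C w₀ : ℝ) (w : (n : ℕ) → Fin n → ℝ) : Prop :=
  HasPowerLawTail τ C w₀ (fun n => empiricalCDF (w n) Finset.univ) (fun n => cutoff τ n)

/-- The weights of the `k n` community vertices have a power-law tail with the same constants,
for `w₀ ≤ x = O(k^(1/(τ-1)) / log k)`. -/
def PowerLawCommunityWeights (τ C w₀ : ℝ) (k : ℕ → ℕ) (w : (n : ℕ) → Fin n → ℝ) : Prop :=
  ∀ A : ℝ, 0 < A →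
    HasPowerLawTail τ C w₀ (fun n => empiricalCDF (w n) (community n (k n)))
      (fun n => A * cutoff τ (k n))

/-- The total weight of the vertices that lie beyond the range `x ≤ n^(1/(τ-1)) / log n`. -/
def excessWeight (τ : ℝ) {n : ℕ} (w : Fin n → ℝ) : ℝ :=
  ∑ i ∈ Finset.univ.filter (fun i => cutoff τ n < w i), w i

/-! ### Random graphs with conditionally independent edges -/

/-- The probability of the graph `G` when each edge `{i, j}`, `i < j`, is present with probability
`p i j`, independently of all other edges. -/
def graphMass {n : ℕ} (p : Fin n → Fin n → ℝ) (G : SimpleGraph (Fin n)) : ℝ :=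
  open Classical in
  ∏ e ∈ Finset.univ.filter (fun e : Fin n × Fin n => e.1 < e.2),
    if G.Adj e.1 e.2 then p e.1 e.2 else 1 - p e.1 e.2

/-- The probability of the event `A` for a graph with independent edges. -/
def graphProb {n : ℕ} (p : Fin n → Fin n → ℝ) (A : Set (SimpleGraph (Fin n))) : ℝ :=
  open Classical in
  ∑ G ∈ Finset.univ.filter (fun G : SimpleGraph (Fin n) => G ∈ A), graphMass p G

/-- The constant `μ = w₀ (τ - 1) / (τ - 2)`. -/
def meanWeight (τ w₀ : ℝ) : ℝ := w₀ * ((τ - 1) / (τ - 2))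

/-- Connection probability of the inhomogeneous random graph. -/
def irgEdge (μ : ℝ) {n : ℕ} (w : Fin n → ℝ) (i j : Fin n) : ℝ :=
  min (w i * w j / (μ * n)) 1

/-- `min (s / r, 1) ^ γ`, where `s / 0 = ∞`, and where for `γ = ∞` this is
the indicator of `r ≤ s` (for `s > 0` and `r ≥ 0`). -/
def kernel (γ : ℝ≥0∞) (s r : ℝ) : ℝ :=
  if r = 0 then 1
  else if γ = ⊤ then (if r ≤ s then 1 else 0)
  else (min (s / r) 1) ^ γ.toReal

/-- The constant `C₁ = (1 + (γ - 1)⁻¹) 2 ^ d`, with `∞⁻¹ = 0`. -/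
def corrConst (d : ℕ) (γ : ℝ≥0∞) : ℝ := (1 + ((γ - 1)⁻¹).toReal) * 2 ^ d

/-- Edge probabilities of the alternative model on `n` vertices, given the positions `x` of the
community vertices in the torus `(ℝ / ℤ) ^ d`. The norm on `UnitAddTorus (Fin d)` is the maximum
over the coordinates of the distance to the nearest integer. -/
def altEdge (d : ℕ) (γ : ℝ≥0∞) (μ : ℝ) {n : ℕ} (k : ℕ) (w : Fin n → ℝ)
    (x : Fin k → UnitAddTorus (Fin d)) (i j : Fin n) : ℝ :=
  1 / (1 + corrConst d γ) *
    if h : i.val < k ∧ j.val < k then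
      kernel γ (w i * w j) (μ * k * ‖x ⟨i.val, h.1⟩ - x ⟨j.val, h.2⟩‖ ^ d)
    else irgEdge μ w i j

/-- The probability `P₀(A)` under the null hypothesis. -/
def nullProb (μ : ℝ) {n : ℕ} (w : Fin n → ℝ) (A : Set (SimpleGraph (Fin n))) : ℝ :=
  graphProb (irgEdge μ w) A

/-- The probability `P₁(A)` under the alternative hypothesis: the positions of the `k` community
vertices are independent and uniform on the torus, and given the positions the edges are
independent. -/
def altProb (d : ℕ) (γ : ℝ≥0∞) (μ : ℝ) {n : ℕ} (k : ℕ) (w : Fin n → ℝ)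
    (A : Set (SimpleGraph (Fin n))) : ℝ :=
  ∫ x : Fin k → UnitAddTorus (Fin d), graphProb (altEdge d γ μ k w x) A

/-! ### Tests -/

/-- The weighted triangle statistic: the sum of `1 / (w_a w_b w_c)` over all ordered triples
`(a, b, c)` that form a triangle. -/
def weightedTriangles {n : ℕ} (w : Fin n → ℝ) (G : SimpleGraph (Fin n)) : ℝ :=
  open Classical in
  ∑ a, ∑ b, ∑ c, if G.Adj a b ∧ G.Adj b c ∧ G.Adj c a then 1 / (w a * w b * w c) else 0

/-- The weighted triangle test with threshold `t`; the value `1` means that the null hypothesis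
is rejected. -/
def weightedTriangleTest {n : ℕ} (w : Fin n → ℝ) (t : ℝ) (G : SimpleGraph (Fin n)) : Fin 2 :=
  open Classical in
  if t ≤ weightedTriangles w G then 1 else 0

/-- The risk of a test: the sum of its type-I and type-II error probabilities. -/
def risk (d : ℕ) (γ : ℝ≥0∞) (μ : ℝ) {n : ℕ} (k : ℕ) (w : Fin n → ℝ)
    (ψ : SimpleGraph (Fin n) → Fin 2) : ℝ :=
  nullProb μ w {G | ψ G = 1} + altProb d γ μ k w {G | ψ G = 0}

/-- A sequence of tests is asymptotically powerful if its risk vanishes. -/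
def AsymptoticallyPowerful (d : ℕ) (γ : ℝ≥0∞) (μ : ℝ) (k : ℕ → ℕ) (w : (n : ℕ) → Fin n → ℝ)
    (ψ : (n : ℕ) → SimpleGraph (Fin n) → Fin 2) : Prop :=
  Tendsto (fun n => risk d γ μ (k n) (w n) (ψ n)) atTop (𝓝 0)

end GeoCommunity

end

/-! The statistic has bounded mean under $H_0$ and is of order $k$ under $H_1$, and the threshold
`f` lies between the two scales.

Under $H_0$ a triangle on $a,b,c$ has probability at most $(w_aw_bw_c)^2/(\mu n)^3$. Weighting
leaves $w_aw_bw_c/(\mu n)^3$, so the mean is at most $(\sum_i w_i/(\mu n))^3$. Since $\tau>2$,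
dyadic summation of the tail together with the bound on the excess weight gives $\sum_i w_i=O(n)$
(`exists_sum_weights_le`), and Markov's inequality makes the type-I error $O(1/f)$.

Under $H_1$ it suffices to count a convenient family of triangles. A positive proportion of the
community has weight in $(w_0,6w_0]$ (`card_moderate_weights_ge`). Take three disjoint sets of
$m\asymp k$ such vertices and keep the triples $(a,b,c)$ with $a$ and $c$ within $\rho$ of $b$,
where $v=(2\rho)^d=w_0^2/(\mu k)$. All three pairs then have kernel $1$, so whatever $\gamma$ is,
the triangle has conditional probability $q^3$ with $q=1/(1+C_1)$, and the expected count is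
$e=m^3v^2q^3\asymp k$. Closeness events along a forest are independent (`volume_closeSet`), so only
triples sharing at least two vertices contribute to the variance, at most $3m^4v^3+m^3v^2=O(k)$
(`exists_variance_bound`). Chebyshev's inequality makes the type-II error $O(1/k)$. -/

noncomputable section

namespace GeoCommunity

/-! ### Graphs with independent edges -/

section GraphMass

variable {n : ℕ}

open Classical in
/-- The graph whose edges are the unordered versions of the pairs in `s`. -/
def graphOfPairs (s : Finset (Fin n × Fin n)) : SimpleGraph (Fin n) :=
  SimpleGraph.fromRel fun i j => (i, j) ∈ s

open Classical in
/-- The ordered pairs `i < j`. -/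
def orderedPairs (n : ℕ) : Finset (Fin n × Fin n) := Finset.univ.filter fun e => e.1 < e.2

lemma mem_orderedPairs {e : Fin n × Fin n} : e ∈ orderedPairs n ↔ e.1 < e.2 := by
  simp [orderedPairs]

open Classical in
/-- A product over potential edges, summed over all graphs, factorizes. -/
lemma sum_prod_adj (g h : Fin n × Fin n → ℝ) :
    ∑ G : SimpleGraph (Fin n), ∏ e ∈ orderedPairs n, (if G.Adj e.1 e.2 then g e else h e) =
      ∏ e ∈ orderedPairs n, (g e + h e) := by
  rw [Finset.prod_add]
  -- The expanded product is a sum over sets of ordered pairs, and a graph is the same thing as its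
  -- set of ordered edges.
  refine Finset.sum_bij' (fun G _ => (orderedPairs n).filter fun e => G.Adj e.1 e.2)
    (fun s _ => graphOfPairs s) (by simp) (by simp) ?_ ?_ ?_
  · intro G _
    ext i j
    simp only [graphOfPairs, SimpleGraph.fromRel_adj, Finset.mem_filter, mem_orderedPairs]
    constructor
    · rintro ⟨_, ⟨_, h⟩ | ⟨_, h⟩⟩
      · exact h
      · exact h.symm
    · intro h
      refine ⟨h.ne, ?_⟩
      rcases lt_or_gt_of_ne h.ne with h' | h'
      · exact Or.inl ⟨h', h⟩
      · exact Or.inr ⟨h', h.symm⟩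
  · intro s hs
    rw [Finset.mem_powerset] at hs
    ext ⟨i, j⟩
    simp only [graphOfPairs, SimpleGraph.fromRel_adj, Finset.mem_filter, mem_orderedPairs]
    constructor
    · rintro ⟨hij, _, h | h⟩
      · exact h
      · exact absurd (mem_orderedPairs.1 (hs h)) (by simpa using hij.le)
    · intro h
      have := mem_orderedPairs.1 (hs h)
      exact ⟨this, this.ne, Or.inl h⟩
  · intro G _
    rw [Finset.prod_ite, ← Finset.filter_not]

lemma graphMass_nonneg {p : Fin n → Fin n → ℝ} (h0 : ∀ i j, 0 ≤ p i j) (h1 : ∀ i j, p i j ≤ 1)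
    (G : SimpleGraph (Fin n)) : 0 ≤ graphMass p G := by
  classical
  unfold graphMass
  refine Finset.prod_nonneg fun e _ => ?_
  split_ifs
  · exact h0 _ _
  · linarith [h1 e.1 e.2]

open Classical in
/-- The probability that all pairs of `E` are edges. -/
lemma sum_graphMass_subset (p : Fin n → Fin n → ℝ) {E : Finset (Fin n × Fin n)}
    (hE : E ⊆ orderedPairs n) :
    ∑ G : SimpleGraph (Fin n), graphMass p G * (if ∀ e ∈ E, G.Adj e.1 e.2 then 1 else 0) =
      ∏ e ∈ E, p e.1 e.2 := by
  -- The indicator is absorbed by setting the factor of an absent edge to `0` on `E`. After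
  -- factorization the pairs of `E` contribute `p` and all others `p + (1 - p) = 1`.
  have key : ∀ G : SimpleGraph (Fin n),
      graphMass p G * (if ∀ e ∈ E, G.Adj e.1 e.2 then 1 else 0) =
      ∏ e ∈ orderedPairs n,
        (if G.Adj e.1 e.2 then p e.1 e.2 else if e ∈ E then 0 else 1 - p e.1 e.2) := by
    intro G
    split_ifs with h
    · rw [mul_one]
      unfold graphMass
      refine Finset.prod_congr (by ext; simp [orderedPairs]) fun e _ => ?_
      by_cases he : G.Adj e.1 e.2
      · simp [he]
      · have : e ∉ E := fun h' => he (h e h')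
        simp [he, this]
    · push Not at h
      obtain ⟨e, heE, he⟩ := h
      rw [mul_zero, eq_comm]
      exact Finset.prod_eq_zero (hE heE) (by simp [he, heE])
  rw [Finset.sum_congr rfl fun G _ => key G, sum_prod_adj (fun e => p e.1 e.2)
    (fun e => if e ∈ E then 0 else 1 - p e.1 e.2), ← Finset.prod_subset hE]
  · exact Finset.prod_congr rfl fun e he => by simp [he]
  · intro e _ he
    simp [he]

lemma sum_graphMass (p : Fin n → Fin n → ℝ) : ∑ G, graphMass p G = 1 := by
  classical
  simpa using sum_graphMass_subset p (Finset.empty_subset (orderedPairs n))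

/-- The ordered version of a pair of vertices. -/
def sortPair (i j : Fin n) : Fin n × Fin n := if i < j then (i, j) else (j, i)

lemma sortPair_mem {i j : Fin n} (h : i ≠ j) : sortPair i j ∈ orderedPairs n := by
  rw [mem_orderedPairs, sortPair]
  split_ifs with h'
  · exact h'
  · exact lt_of_le_of_ne (not_lt.1 h') h.symm

lemma adj_sortPair (G : SimpleGraph (Fin n)) (i j : Fin n) :
    G.Adj (sortPair i j).1 (sortPair i j).2 ↔ G.Adj i j := by
  rw [sortPair]
  split_ifs
  · rfl
  · exact G.adj_comm _ _

lemma apply_sortPair {p : Fin n → Fin n → ℝ} (hp : ∀ i j, p i j = p j i) (i j : Fin n) :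
    p (sortPair i j).1 (sortPair i j).2 = p i j := by
  rw [sortPair]
  split_ifs
  · rfl
  · exact hp _ _

lemma sortPair_eq_iff {i j i' j' : Fin n} :
    sortPair i j = sortPair i' j' ↔ (i = i' ∧ j = j') ∨ (i = j' ∧ j = i') := by
  unfold sortPair
  split_ifs <;> simp only [Prod.mk.injEq] <;> grind

/-- `a, b, c` form a triangle. -/
def IsTri (G : SimpleGraph (Fin n)) (a b c : Fin n) : Prop := G.Adj a b ∧ G.Adj b c ∧ G.Adj c a

open Classical in
/-- The edge set of the triangle `a, b, c`. -/
def triPairs (a b c : Fin n) : Finset (Fin n × Fin n) :=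
  {sortPair a b, sortPair b c, sortPair c a}

lemma forall_triPairs (G : SimpleGraph (Fin n)) (a b c : Fin n) :
    (∀ e ∈ triPairs a b c, G.Adj e.1 e.2) ↔ IsTri G a b c := by
  simp [triPairs, IsTri, adj_sortPair]

lemma triPairs_subset {a b c : Fin n} (hab : a ≠ b) (hbc : b ≠ c) (hca : c ≠ a) :
    triPairs a b c ⊆ orderedPairs n := by
  intro e he
  simp only [triPairs, Finset.mem_insert, Finset.mem_singleton] at he
  rcases he with rfl | rfl | rfl
  exacts [sortPair_mem hab, sortPair_mem hbc, sortPair_mem hca]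

lemma prod_triPairs {p : Fin n → Fin n → ℝ} (hp : ∀ i j, p i j = p j i) {a b c : Fin n}
    (hab : a ≠ b) (hbc : b ≠ c) (hca : c ≠ a) :
    ∏ e ∈ triPairs a b c, p e.1 e.2 = p a b * p b c * p c a := by
  classical
  rw [triPairs, Finset.prod_insert, Finset.prod_insert, Finset.prod_singleton,
    apply_sortPair hp, apply_sortPair hp, apply_sortPair hp, mul_assoc]
  · simp only [Finset.mem_singleton, sortPair_eq_iff]
    grind
  · simp only [Finset.mem_insert, Finset.mem_singleton, sortPair_eq_iff]
    grind

open Classical in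
/-- The probability of a triangle. -/
lemma sum_graphMass_isTri {p : Fin n → Fin n → ℝ} (hp : ∀ i j, p i j = p j i) {a b c : Fin n}
    (hab : a ≠ b) (hbc : b ≠ c) (hca : c ≠ a) :
    ∑ G : SimpleGraph (Fin n), graphMass p G * (if IsTri G a b c then 1 else 0) =
      p a b * p b c * p c a := by
  rw [← prod_triPairs hp hab hbc hca, ← sum_graphMass_subset p (triPairs_subset hab hbc hca)]
  exact Finset.sum_congr rfl fun G _ => by simp only [forall_triPairs]

open Classical in
/-- The probability of two edge-disjoint triangles is the product of their probabilities. -/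
lemma sum_graphMass_isTri_isTri {p : Fin n → Fin n → ℝ} (hp : ∀ i j, p i j = p j i)
    {a b c a' b' c' : Fin n} (hab : a ≠ b) (hbc : b ≠ c) (hca : c ≠ a)
    (hab' : a' ≠ b') (hbc' : b' ≠ c') (hca' : c' ≠ a')
    (hdisj : Disjoint (triPairs a b c) (triPairs a' b' c')) :
    ∑ G : SimpleGraph (Fin n), graphMass p G *
        ((if IsTri G a b c then 1 else 0) * (if IsTri G a' b' c' then 1 else 0)) =
      (p a b * p b c * p c a) * (p a' b' * p b' c' * p c' a') := by
  rw [← prod_triPairs hp hab hbc hca, ← prod_triPairs hp hab' hbc' hca',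
    ← Finset.prod_union hdisj, ← sum_graphMass_subset p
      (Finset.union_subset (triPairs_subset hab hbc hca) (triPairs_subset hab' hbc' hca'))]
  refine Finset.sum_congr rfl fun G _ => ?_
  simp only [Finset.mem_union, or_imp, forall_and, forall_triPairs, ite_and, mul_ite, mul_one,
    mul_zero]
  split_ifs <;> rfl

end GraphMass

/-! ### Edge probabilities -/

lemma irgEdge_comm (μ : ℝ) {n : ℕ} (w : Fin n → ℝ) (i j : Fin n) :
    irgEdge μ w i j = irgEdge μ w j i := by
  rw [irgEdge, irgEdge, mul_comm (w i)]

lemma irgEdge_nonneg {μ : ℝ} (hμ : 0 ≤ μ) {n : ℕ} {w : Fin n → ℝ} (hw : ∀ i, 0 < w i)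
    (i j : Fin n) : 0 ≤ irgEdge μ w i j :=
  le_min (div_nonneg (mul_pos (hw i) (hw j)).le (by positivity)) zero_le_one

lemma irgEdge_le_one (μ : ℝ) {n : ℕ} (w : Fin n → ℝ) (i j : Fin n) : irgEdge μ w i j ≤ 1 :=
  min_le_right _ _

lemma kernel_nonneg (γ : ℝ≥0∞) {s r : ℝ} (hs : 0 ≤ s) (hr : 0 ≤ r) : 0 ≤ kernel γ s r := by
  unfold kernel
  split_ifs
  · exact zero_le_one
  · exact zero_le_one
  · exact le_rfl
  · exact Real.rpow_nonneg (le_min (div_nonneg hs hr) zero_le_one) _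

lemma kernel_le_one (γ : ℝ≥0∞) {s r : ℝ} (hs : 0 ≤ s) (hr : 0 ≤ r) : kernel γ s r ≤ 1 := by
  unfold kernel
  split_ifs
  · exact le_rfl
  · exact le_rfl
  · exact zero_le_one
  · exact Real.rpow_le_one (le_min (div_nonneg hs hr) zero_le_one) (min_le_right _ _)
      ENNReal.toReal_nonneg

/-- In this range all exponents, `⊤` included, agree; hence `γ` enters the type-II bound only
through `corrConst`. -/
lemma kernel_eq_one (γ : ℝ≥0∞) {s r : ℝ} (hr : 0 ≤ r) (hrs : r ≤ s) : kernel γ s r = 1 := by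
  unfold kernel
  split_ifs with h
  · rfl
  · rfl
  · rw [min_eq_right, Real.one_rpow]
    rwa [one_le_div (lt_of_le_of_ne hr (Ne.symm h))]

lemma corrConst_nonneg (d : ℕ) (γ : ℝ≥0∞) : 0 ≤ corrConst d γ := by
  unfold corrConst
  positivity

section AltEdge

variable {d : ℕ} {γ : ℝ≥0∞} {μ : ℝ} {n k : ℕ} {w : Fin n → ℝ}
  {x : Fin k → UnitAddTorus (Fin d)}

lemma altEdge_comm (i j : Fin n) : altEdge d γ μ k w x i j = altEdge d γ μ k w x j i := by
  unfold altEdge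
  by_cases h : i.val < k ∧ j.val < k
  · rw [dif_pos h, dif_pos h.symm, norm_sub_rev, mul_comm (w i)]
  · rw [dif_neg h, dif_neg (fun h' => h h'.symm), irgEdge_comm]

lemma altEdge_nonneg (hμ : 0 ≤ μ) (hw : ∀ i, 0 < w i) (i j : Fin n) :
    0 ≤ altEdge d γ μ k w x i j := by
  have := corrConst_nonneg d γ
  unfold altEdge
  refine mul_nonneg (by positivity) ?_
  split_ifs
  · exact kernel_nonneg _ (mul_pos (hw i) (hw j)).le (by positivity)
  · exact irgEdge_nonneg hμ hw i j

lemma altEdge_le_one (hμ : 0 ≤ μ) (hw : ∀ i, 0 < w i) (i j : Fin n) :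
    altEdge d γ μ k w x i j ≤ 1 := by
  have := corrConst_nonneg d γ
  have h1 : 1 / (1 + corrConst d γ) ≤ 1 := by
    rw [div_le_one (by positivity)]
    linarith
  unfold altEdge
  refine mul_le_one₀ h1 ?_ ?_
  · split_ifs
    · exact kernel_nonneg _ (mul_pos (hw i) (hw j)).le (by positivity)
    · exact irgEdge_nonneg hμ hw i j
  · split_ifs
    · exact kernel_le_one _ (mul_pos (hw i) (hw j)).le (by positivity)
    · exact irgEdge_le_one _ _ _ _

/-- Close community vertices are joined with the maximal probability. -/
lemma altEdge_castLE (hk : k ≤ n) (hμ : 0 ≤ μ) {a b : Fin k}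
    (h : μ * k * ‖x a - x b‖ ^ d ≤ w (Fin.castLE hk a) * w (Fin.castLE hk b)) :
    altEdge d γ μ k w x (Fin.castLE hk a) (Fin.castLE hk b) = 1 / (1 + corrConst d γ) := by
  unfold altEdge
  rw [dif_pos (by simp)]
  simp only [Fin.val_castLE, Fin.eta]
  rw [kernel_eq_one _ (by positivity) h, mul_one]

end AltEdge

/-! ### Close pairs of uniform points on the torus -/

section Positions

variable {ι : Type*} {d : ℕ}

/-- The configurations in which all pairs of `l` are at distance at most `ρ`. -/
def closeSet (ρ : ℝ) (l : List (ι × ι)) : Set (ι → UnitAddTorus (Fin d)) :=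
  {x | ∀ e ∈ l, ‖x e.1 - x e.2‖ ≤ ρ}

variable [Fintype ι]

instance isProbabilityMeasure_torus :
    IsProbabilityMeasure (volume : Measure (UnitAddTorus (Fin d))) :=
  ⟨by simp [volume_pi, Measure.pi_univ]⟩

instance isProbabilityMeasure_positions :
    IsProbabilityMeasure (volume : Measure (ι → UnitAddTorus (Fin d))) :=
  ⟨by simp [volume_pi (α := fun _ : ι => UnitAddTorus (Fin d))]⟩

lemma measurableSet_closeSet (ρ : ℝ) (l : List (ι × ι)) :
    MeasurableSet (closeSet ρ l : Set (ι → UnitAddTorus (Fin d))) := by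
  have : (closeSet ρ l : Set (ι → UnitAddTorus (Fin d))) =
      ⋂ e ∈ {e | e ∈ l}, {x | ‖x e.1 - x e.2‖ ≤ ρ} := by
    ext; simp [closeSet]
  rw [this]
  refine IsClosed.measurableSet (isClosed_biInter fun e _ => isClosed_le ?_ continuous_const)
  fun_prop

/-- A ball in the maximum norm is a product of arcs of length `2 * ρ`, and `2 * ρ ≤ 1` keeps the
arcs from wrapping around the circle. -/
lemma volume_closedBall_torus {ρ : ℝ} (hρ : 0 ≤ ρ) (hρ' : 2 * ρ ≤ 1) (y : UnitAddTorus (Fin d)) :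
    volume (Metric.closedBall y ρ) = ENNReal.ofReal ((2 * ρ) ^ d) := by
  rw [closedBall_pi _ hρ, volume_pi, Measure.pi_pi]
  have : ∀ z : UnitAddCircle, volume (Metric.closedBall z ρ) = ENNReal.ofReal (2 * ρ) := by
    intro z
    rw [AddCircle.volume_closedBall, min_eq_right hρ']
  simp [this, ENNReal.ofReal_pow (by positivity : 0 ≤ 2 * ρ)]

/-- If the pairs of `l` form a forest (each pair has a leaf that does not occur in the
later pairs), then the events that they are close behave as if they were independent. -/
lemma volume_closeSet {ρ : ℝ} (hρ : 0 ≤ ρ) (hρ' : 2 * ρ ≤ 1) (l : List (ι × ι))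
    (hne : ∀ e ∈ l, e.1 ≠ e.2) (hl : l.Pairwise fun e e' => e'.1 ≠ e.1 ∧ e'.2 ≠ e.1) :
    volume (closeSet ρ l : Set (ι → UnitAddTorus (Fin d))) =
      ENNReal.ofReal ((2 * ρ) ^ d) ^ l.length := by
  classical
  induction l with
  | nil =>
    have : (closeSet ρ [] : Set (ι → UnitAddTorus (Fin d))) = Set.univ := by simp [closeSet]
    rw [this, measure_univ, List.length_nil, pow_zero]
  | cons e l ih =>
    obtain ⟨i, j⟩ := e
    rw [List.pairwise_cons] at hl
    have hij : i ≠ j := hne (i, j) (by simp)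
    specialize ih (fun e he => hne e (by simp [he])) hl.2
    have hupd : ∀ (x : ι → UnitAddTorus (Fin d)) y,
        Function.update x i y ∈ (closeSet ρ l : Set (ι → UnitAddTorus (Fin d))) ↔
          x ∈ (closeSet ρ l : Set (ι → UnitAddTorus (Fin d))) := by
      intro x y
      refine forall₂_congr fun e he => ?_
      rw [Function.update_of_ne (hl.1 e he).1, Function.update_of_ne (hl.1 e he).2]
    have hupd' : ∀ (x : ι → UnitAddTorus (Fin d)) y,
        Function.update x i y ∈ (closeSet ρ ((i, j) :: l) : Set (ι → UnitAddTorus (Fin d))) ↔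
          y ∈ Metric.closedBall (x j) ρ ∧
            x ∈ (closeSet ρ l : Set (ι → UnitAddTorus (Fin d))) := by
      intro x y
      rw [← hupd x y]
      simp [closeSet, Function.update_of_ne hij.symm, dist_eq_norm]
    have hm := measurableSet_closeSet (d := d) ρ ((i, j) :: l)
    have hm' := measurableSet_closeSet (d := d) ρ l
    rw [List.length_cons, pow_succ', ← ih, ← lintegral_indicator_one hm,
      ← lintegral_indicator_one hm',
      ← lintegral_const_mul _ (measurable_one.indicator hm'), volume_pi]
    -- Only the leaf `i` is integrated out: the pairs of `l` do not involve it, and the first pair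
    -- gives the volume of a ball, which does not depend on its centre `x j`.
    refine lintegral_eq_of_lmarginal_eq {i} (measurable_one.indicator hm)
      ((measurable_one.indicator hm').const_mul _) ?_
    funext x
    rw [lmarginal_singleton, lmarginal_singleton]
    have h1 : ∀ y, (closeSet ρ ((i, j) :: l) :
        Set (ι → UnitAddTorus (Fin d))).indicator (1 : (ι → UnitAddTorus (Fin d)) → ℝ≥0∞) (Function.update x i y) =
        (closeSet ρ l : Set (ι → UnitAddTorus (Fin d))).indicator 1 x *
          (Metric.closedBall (x j) ρ).indicator 1 y := by
      intro y
      simp only [Set.indicator_apply, hupd', Pi.one_apply]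
      by_cases h : y ∈ Metric.closedBall (x j) ρ <;> simp [h]
    have h2 : ∀ y, (closeSet ρ l :
        Set (ι → UnitAddTorus (Fin d))).indicator (1 : (ι → UnitAddTorus (Fin d)) → ℝ≥0∞) (Function.update x i y) =
        (closeSet ρ l : Set (ι → UnitAddTorus (Fin d))).indicator 1 x := by
      intro y
      simp only [Set.indicator_apply, hupd, Pi.one_apply]
    simp only [h1, h2]
    rw [lintegral_const_mul _ (measurable_one.indicator Metric.isClosed_closedBall.measurableSet),
      lintegral_indicator_one Metric.isClosed_closedBall.measurableSet,
      volume_closedBall_torus hρ hρ']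
    simp [mul_comm]

lemma measureReal_closeSet {ρ : ℝ} (hρ : 0 ≤ ρ) (hρ' : 2 * ρ ≤ 1) (l : List (ι × ι))
    (hne : ∀ e ∈ l, e.1 ≠ e.2) (hl : l.Pairwise fun e e' => e'.1 ≠ e.1 ∧ e'.2 ≠ e.1) :
    volume.real (closeSet ρ l : Set (ι → UnitAddTorus (Fin d))) = ((2 * ρ) ^ d) ^ l.length := by
  rw [Measure.real, volume_closeSet hρ hρ' l hne hl, ENNReal.toReal_pow,
    ENNReal.toReal_ofReal (by positivity)]

/-- Dropping constraints enlarges the event, so a list with cycles or repetitions is controlled by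
any forest inside it; pairs may be reversed because the distance is symmetric. -/
lemma measureReal_closeSet_le {ρ : ℝ} (hρ : 0 ≤ ρ) (hρ' : 2 * ρ ≤ 1) {l l' : List (ι × ι)}
    (hll : ∀ e ∈ l, e ∈ l' ∨ e.swap ∈ l')
    (hne : ∀ e ∈ l, e.1 ≠ e.2) (hl : l.Pairwise fun e e' => e'.1 ≠ e.1 ∧ e'.2 ≠ e.1) :
    volume.real (closeSet ρ l' : Set (ι → UnitAddTorus (Fin d))) ≤ ((2 * ρ) ^ d) ^ l.length := by
  rw [← measureReal_closeSet hρ hρ' l hne hl]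
  exact measureReal_mono fun x hx e he => (hll e he).elim (hx e) fun h => by
    simpa [norm_sub_rev] using hx _ h

end Positions

/-! ### The null hypothesis -/

lemma weightedTriangles_eq {n : ℕ} (w : Fin n → ℝ) (G : SimpleGraph (Fin n)) :
    weightedTriangles w G = open Classical in
      ∑ a, ∑ b, ∑ c, (if IsTri G a b c then 1 else 0) * (1 / (w a * w b * w c)) := by
  classical
  unfold weightedTriangles
  refine Finset.sum_congr rfl fun a _ => Finset.sum_congr rfl fun b _ =>
    Finset.sum_congr rfl fun c _ => ?_
  rw [ite_mul, one_mul, zero_mul]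
  exact if_congr Iff.rfl rfl rfl

lemma weightedTriangles_nonneg {n : ℕ} {w : Fin n → ℝ} (hw : ∀ i, 0 < w i)
    (G : SimpleGraph (Fin n)) : 0 ≤ weightedTriangles w G := by
  classical
  rw [weightedTriangles_eq]
  refine Finset.sum_nonneg fun a _ => Finset.sum_nonneg fun b _ => Finset.sum_nonneg fun c _ => ?_
  have := hw a
  have := hw b
  have := hw c
  split_ifs <;> positivity

/-- The expected weighted number of triangles under the null hypothesis. -/
lemma sum_graphMass_irgEdge_weightedTriangles_le {μ : ℝ} (hμ : 0 < μ) {n : ℕ} {w : Fin n → ℝ}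
    (hw : ∀ i, 0 < w i) :
    ∑ G, graphMass (irgEdge μ w) G * weightedTriangles w G ≤ ((∑ i, w i) / (μ * n)) ^ 3 := by
  classical
  have htri : ∀ a b c, ∑ G, graphMass (irgEdge μ w) G *
      ((if IsTri G a b c then 1 else 0) * (1 / (w a * w b * w c))) ≤
      w a / (μ * n) * (w b / (μ * n)) * (w c / (μ * n)) := by
    intro a b c
    have hn : (0 : ℝ) < n := Nat.cast_pos.2 a.pos
    have ha := hw a
    have hb := hw b
    have hc := hw c
    by_cases hd : a ≠ b ∧ b ≠ c ∧ c ≠ a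
    · simp only [← mul_assoc]
      rw [← Finset.sum_mul, sum_graphMass_isTri (irgEdge_comm μ w) hd.1 hd.2.1 hd.2.2]
      have h : ∀ i j, irgEdge μ w i j ≤ w i * w j / (μ * n) := fun i j => min_le_left _ _
      have h0 := irgEdge_nonneg hμ.le hw
      calc irgEdge μ w a b * irgEdge μ w b c * irgEdge μ w c a * (1 / (w a * w b * w c))
          ≤ (w a * w b / (μ * n)) * (w b * w c / (μ * n)) * (w c * w a / (μ * n)) *
            (1 / (w a * w b * w c)) := by
            refine mul_le_mul_of_nonneg_right ?_ (by positivity)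
            exact mul_le_mul (mul_le_mul (h a b) (h b c) (h0 _ _) (by positivity)) (h c a)
              (h0 _ _) (by positivity)
        -- Each vertex lies on two edges of the triangle, and one of its two weight factors cancels.
        _ = w a / (μ * n) * (w b / (μ * n)) * (w c / (μ * n)) := by
            field_simp
    · have : ∀ G : SimpleGraph (Fin n), ¬ IsTri G a b c :=
        fun G h => hd ⟨h.1.ne, h.2.1.ne, h.2.2.ne⟩
      simp only [this, if_false, zero_mul, mul_zero, Finset.sum_const_zero]
      positivity
  calc ∑ G, graphMass (irgEdge μ w) G * weightedTriangles w G
      = ∑ a, ∑ b, ∑ c, ∑ G, graphMass (irgEdge μ w) G *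
      ((if IsTri G a b c then 1 else 0) * (1 / (w a * w b * w c))) := by
        simp only [weightedTriangles_eq, Finset.mul_sum]
        rw [Finset.sum_comm]
        refine Finset.sum_congr rfl fun a _ => ?_
        rw [Finset.sum_comm]
        refine Finset.sum_congr rfl fun b _ => ?_
        rw [Finset.sum_comm]
    _ ≤ ∑ a, ∑ b, ∑ c, w a / (μ * n) * (w b / (μ * n)) * (w c / (μ * n)) :=
        Finset.sum_le_sum fun a _ => Finset.sum_le_sum fun b _ => Finset.sum_le_sum fun c _ =>
          htri a b c
    _ = ((∑ i, w i) / (μ * n)) ^ 3 := by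
        rw [Finset.sum_div, pow_three', Finset.sum_mul_sum, Finset.sum_mul]
        refine Finset.sum_congr rfl fun a _ => ?_
        rw [Finset.sum_mul_sum]

/-- The type-I error of the weighted triangle test. -/
lemma nullProb_weightedTriangles_le {μ : ℝ} (hμ : 0 < μ) {n : ℕ} {w : Fin n → ℝ}
    (hw : ∀ i, 0 < w i) {t : ℝ} (ht : 0 < t) :
    nullProb μ w {G | t ≤ weightedTriangles w G} ≤ ((∑ i, w i) / (μ * n)) ^ 3 / t := by
  classical
  have hm := graphMass_nonneg (irgEdge_nonneg hμ.le hw) (irgEdge_le_one μ w)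
  refine le_trans ?_ (div_le_div_of_nonneg_right
    (sum_graphMass_irgEdge_weightedTriangles_le hμ hw) ht.le)
  unfold nullProb graphProb
  rw [Finset.sum_div]
  -- Markov's inequality.
  refine (Finset.sum_le_sum fun G hG => ?_).trans
    (Finset.sum_le_sum_of_subset_of_nonneg (Finset.filter_subset _ _) fun G _ _ => ?_)
  · have hG' : t ≤ weightedTriangles w G := by simpa using hG
    rw [le_div_iff₀ ht]
    exact mul_le_mul_of_nonneg_left hG' (hm G)
  · exact div_nonneg (mul_nonneg (hm G) (weightedTriangles_nonneg hw G)) ht.le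

/-! ### The total weight -/

lemma card_mul_one_sub_empiricalCDF {n : ℕ} (w : Fin n → ℝ) (S : Finset (Fin n)) (x : ℝ) :
    (S.card : ℝ) * (1 - empiricalCDF w S x) = (S.filter fun i => x < w i).card := by
  have h := Finset.card_filter_add_card_filter_not (s := S) (fun i => w i ≤ x)
  simp only [not_le] at h
  rcases S.eq_empty_or_nonempty with rfl | hS
  · simp
  · have : (0 : ℝ) < S.card := Nat.cast_pos.2 hS.card_pos
    unfold empiricalCDF
    rw [← h]
    rw [← h] at this
    push_cast at this ⊢
    field_simp
    ring

/-- If $w_02^j$ is the largest level below $x$, the right side telescopes to $w_02^{j+1}\ge x$. This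
expresses weights through exceedances of levels, which the tail controls. -/
lemma le_add_sum_dyadic {w₀ x : ℝ} (hw₀ : 0 < w₀) (J : ℕ) (hx : x ≤ w₀ * 2 ^ J) :
    x ≤ w₀ + ∑ j ∈ Finset.range J, if w₀ * 2 ^ j < x then w₀ * 2 ^ j else 0 := by
  induction J with
  | zero => simpa using hx
  | succ J ih =>
    rw [Finset.sum_range_succ]
    split_ifs with h
    · have : ∀ j ∈ Finset.range J, (if w₀ * 2 ^ j < x then w₀ * 2 ^ j else 0) = w₀ * 2 ^ j := by
        intro j hj
        rw [if_pos]
        refine lt_of_le_of_lt ?_ h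
        gcongr
        · norm_num
        · exact (Finset.mem_range.1 hj).le
      rw [Finset.sum_congr rfl this, ← Finset.mul_sum, geom_sum_eq (by norm_num)]
      rw [pow_succ] at hx
      linarith
    · rw [add_zero]
      exact ih (not_lt.1 h)

/-- A power-law tail with exponent `τ > 2` forces the total weight within the range of the power
law to be linear. -/
lemma sum_filter_le_of_tail {τ C w₀ b : ℝ} (hτ : 2 < τ) (hC : 0 < C) (hw₀ : 0 < w₀)
    {n : ℕ} (w : Fin n → ℝ)
    (htail : ∀ x, w₀ ≤ x → x ≤ b →
      |(1 - empiricalCDF w Finset.univ x) - C * x ^ (1 - τ)| ≤ 1 * (C * x ^ (1 - τ))) :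
    ∑ i ∈ Finset.univ.filter (fun i => w i ≤ b), w i ≤
      (w₀ + 2 * C * w₀ ^ (2 - τ) * (1 - 2 ^ (2 - τ))⁻¹) * n := by
  -- Any `J` that covers all weights will do: the geometric series is completed at the end, so the
  -- bound does not depend on it.
  obtain ⟨J, hJ⟩ : ∃ J : ℕ, ∀ i, w i ≤ w₀ * 2 ^ J := by
    have h1 : ∀ i, ∀ᶠ J : ℕ in atTop, w i ≤ w₀ * 2 ^ J := fun i =>
      ((tendsto_pow_atTop_atTop_of_one_lt one_lt_two).const_mul_atTop hw₀).eventually_ge_atTop _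
    exact (eventually_all.2 h1).exists
  set r : ℝ := 2 ^ (2 - τ) with hr
  have hr0 : 0 < r := by positivity
  have hr1 : r < 1 := Real.rpow_lt_one_of_one_lt_of_neg one_lt_two (by linarith)
  -- At most $2nCx^{1-\tau}$ weights exceed a level $x\le b$, so the level contributes at most
  -- $2nCx^{2-\tau}$, which decays geometrically in `j` with ratio `r`. Levels above `b` contribute
  -- nothing.
  have hlevel : ∀ j : ℕ,
      ∑ i ∈ Finset.univ.filter (fun i => w i ≤ b), (if w₀ * 2 ^ j < w i then w₀ * 2 ^ j else 0) ≤
      n * (2 * C * w₀ ^ (2 - τ) * r ^ j) := by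
    intro j
    have hx : 0 < w₀ * 2 ^ j := by positivity
    by_cases hb : w₀ * 2 ^ j ≤ b
    · have h1 := htail (w₀ * 2 ^ j) (le_mul_of_one_le_right hw₀.le (one_le_pow₀ one_le_two)) hb
      have h2 := (abs_le.1 h1).2
      have h3 := card_mul_one_sub_empiricalCDF w Finset.univ (w₀ * 2 ^ j)
      rw [Finset.card_univ, Fintype.card_fin] at h3
      calc ∑ i ∈ Finset.univ.filter (fun i => w i ≤ b),
            (if w₀ * 2 ^ j < w i then w₀ * 2 ^ j else 0)
          ≤ ∑ i, (if w₀ * 2 ^ j < w i then w₀ * 2 ^ j else 0) :=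
            Finset.sum_le_sum_of_subset_of_nonneg (Finset.filter_subset _ _)
              fun i _ _ => by split_ifs <;> positivity
        _ = (Finset.univ.filter fun i => w₀ * 2 ^ j < w i).card * (w₀ * 2 ^ j) := by
            rw [← Finset.sum_filter, Finset.sum_const, nsmul_eq_mul]
        _ = n * ((1 - empiricalCDF w Finset.univ (w₀ * 2 ^ j)) * (w₀ * 2 ^ j)) := by
            rw [← h3, mul_assoc]
        _ ≤ n * (2 * C * (w₀ * 2 ^ j) ^ (1 - τ) * (w₀ * 2 ^ j)) := by
            gcongr
            linarith
        _ = n * (2 * C * (w₀ * 2 ^ j) ^ (2 - τ)) := by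
            rw [mul_assoc (2 * C), ← Real.rpow_add_one hx.ne']
            ring_nf
        _ = n * (2 * C * w₀ ^ (2 - τ) * r ^ j) := by
            rw [Real.mul_rpow hw₀.le (by positivity), hr, ← Real.rpow_natCast,
              ← Real.rpow_natCast, ← Real.rpow_mul (by norm_num), ← Real.rpow_mul (by norm_num),
              mul_comm (j : ℝ)]
            ring
    · rw [Finset.sum_eq_zero]
      · positivity
      · intro i hi
        have : w i ≤ b := by simpa using hi
        rw [if_neg]
        linarith
  calc ∑ i ∈ Finset.univ.filter (fun i => w i ≤ b), w i
      ≤ ∑ i ∈ Finset.univ.filter (fun i => w i ≤ b),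
          (w₀ + ∑ j ∈ Finset.range J, if w₀ * 2 ^ j < w i then w₀ * 2 ^ j else 0) :=
        Finset.sum_le_sum fun i _ => le_add_sum_dyadic hw₀ J (hJ i)
    _ ≤ n * w₀ + ∑ j ∈ Finset.range J, n * (2 * C * w₀ ^ (2 - τ) * r ^ j) := by
        rw [Finset.sum_add_distrib, Finset.sum_comm, Finset.sum_const, nsmul_eq_mul]
        refine add_le_add (mul_le_mul_of_nonneg_right ?_ hw₀.le)
          (Finset.sum_le_sum fun j _ => hlevel j)
        exact_mod_cast (Finset.card_le_univ _).trans (Fintype.card_fin n).le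
    _ = (w₀ + 2 * C * w₀ ^ (2 - τ) * ∑ j ∈ Finset.range J, r ^ j) * n := by
        rw [← Finset.mul_sum, ← Finset.mul_sum]
        ring
    _ ≤ (w₀ + 2 * C * w₀ ^ (2 - τ) * (1 - r)⁻¹) * n := by
        gcongr
        rw [← tsum_geometric_of_lt_one hr0.le hr1]
        exact (summable_geometric_of_lt_one hr0.le hr1).sum_le_tsum _ fun j _ => by positivity

/-- The total weight is linear. -/
lemma exists_sum_weights_le {τ C w₀ : ℝ} (hτ : 2 < τ) (hC : 0 < C) (hw₀ : 0 < w₀)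
    {w : (n : ℕ) → Fin n → ℝ} (hw₁ : PowerLawWeights τ C w₀ w)
    (hexc : (fun n => excessWeight τ (w n)) =O[atTop] (fun n => (n : ℝ))) :
    ∃ K : ℝ, ∀ᶠ n : ℕ in atTop, ∑ i, w n i ≤ K * n := by
  obtain ⟨K, hK⟩ := hexc.bound
  refine ⟨w₀ + 2 * C * w₀ ^ (2 - τ) * (1 - 2 ^ (2 - τ))⁻¹ + K, ?_⟩
  filter_upwards [hK, hw₁ 1 one_pos] with n hn hn'
  rw [← Finset.sum_filter_add_sum_filter_not Finset.univ (fun i => w n i ≤ cutoff τ n), add_mul]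
  refine add_le_add (sum_filter_le_of_tail hτ hC hw₀ (w n) hn') ?_
  simp only [not_le]
  have := (le_abs_self _).trans hn
  simpa [excessWeight] using this

/-! ### The alternative hypothesis: second moment of the number of localized triangles -/

/-- A common edge needs two common vertices. The first six hypotheses exclude coincidences between
different positions, the last three exclude two coincidences at equal positions. -/
lemma disjoint_triPairs {n : ℕ} {a b c a' b' c' : Fin n}
    (hab : a ≠ b') (hac : a ≠ c') (hba : b ≠ a') (hbc : b ≠ c') (hca : c ≠ a') (hcb : c ≠ b')
    (h₁ : a = a' → b ≠ b') (h₂ : a = a' → c ≠ c') (h₃ : b = b' → c ≠ c') :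
    Disjoint (triPairs a b c) (triPairs a' b' c') := by
  classical
  rw [Finset.disjoint_left]
  intro e he he'
  simp only [triPairs, Finset.mem_insert, Finset.mem_singleton] at he he'
  rcases he with rfl | rfl | rfl <;> simp only [sortPair_eq_iff] at he' <;> grind

/-- The two pairs that have to be close for the triple `t` to be localized. -/
def starPairs {ι : Type*} (t : ι × ι × ι) : List (ι × ι) := [(t.1, t.2.1), (t.2.2, t.2.1)]

section SecondMoment

variable {d k : ℕ}

set_option linter.unusedSimpArgs false in
/-- Upper bounds for the probability that two triples are localized, according to the vertices
that they share. -/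
lemma measureReal_closeSet_starPairs_mul_le {ρ : ℝ} (hρ : 0 ≤ ρ) (hρ' : 2 * ρ ≤ 1)
    {q : ℝ} (hq : 0 ≤ q) {a b c a' b' c' : Fin k}
    (hab : a ≠ b) (hac : a ≠ c) (hbc : b ≠ c)
    (hab' : a' ≠ b') (hac' : a' ≠ c') (hbc' : b' ≠ c')
    (h1 : a ≠ b') (h2 : a ≠ c') (h3 : b ≠ a') (h4 : b ≠ c') (h5 : c ≠ a') (h6 : c ≠ b') :
    volume.real (closeSet ρ (starPairs (a, b, c) ++ starPairs (a', b', c')) :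
        Set (Fin k → UnitAddTorus (Fin d))) *
      (if (a = a' ∧ b = b') ∨ (a = a' ∧ c = c') ∨ (b = b' ∧ c = c') then 1 else q ^ 6) ≤
      ((2 * ρ) ^ d) ^ 4 * q ^ 6 + (if a = a' ∧ b = b' then ((2 * ρ) ^ d) ^ 3 else 0) +
        (if a = a' ∧ c = c' then ((2 * ρ) ^ d) ^ 3 else 0) +
        (if b = b' ∧ c = c' then ((2 * ρ) ^ d) ^ 3 else 0) +
        (if a = a' ∧ b = b' ∧ c = c' then ((2 * ρ) ^ d) ^ 2 else 0) := by
  have bound : ∀ l : List (Fin k × Fin k),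
      (∀ e ∈ l, e ∈ starPairs (a, b, c) ++ starPairs (a', b', c') ∨
        e.swap ∈ starPairs (a, b, c) ++ starPairs (a', b', c')) →
      ((∀ e ∈ l, e.1 ≠ e.2) ∧ l.Pairwise fun e e' => e'.1 ≠ e.1 ∧ e'.2 ≠ e.1) →
      volume.real (closeSet ρ (starPairs (a, b, c) ++ starPairs (a', b', c')) :
        Set (Fin k → UnitAddTorus (Fin d))) ≤ ((2 * ρ) ^ d) ^ l.length :=
    fun l hl hl' => measureReal_closeSet_le hρ hρ' hl hl'.1 hl'.2
  simp only [starPairs, List.cons_append, List.nil_append] at bound ⊢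
  have hv : 0 ≤ (2 * ρ) ^ d := by positivity
  generalize (2 * ρ) ^ d = v at *
  generalize volume.real (closeSet ρ [(a, b), (c, b), (a', b'), (c', b')] :
    Set (Fin k → UnitAddTorus (Fin d))) = V at *
  clear hρ hρ'
  have hv2 : 0 ≤ v ^ 2 := by positivity
  have hv3 : 0 ≤ v ^ 3 := by positivity
  have hv4 : 0 ≤ v ^ 4 * q ^ 6 := by positivity
  -- In each case the list passed to `bound` is a spanning forest of the required pairs, ordered and
  -- oriented so that each pair begins with a vertex absent from the later ones.
  by_cases ha : a = a' <;> by_cases hb : b = b' <;> by_cases hc : c = c'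
  · have := bound [(a, b), (c, b)]
      (by simp [ha, hb, hc]) (by simp; grind)
    simp only [List.length_cons, List.length_nil, Nat.reduceAdd] at this
    simp only [ha, hb, hc, and_true, and_false, or_true, or_false, if_true, if_false]
    linarith
  · have := bound [(a, b), (c, b), (c', b)]
      (by simp [ha, hb, hc]) (by simp; grind)
    simp only [List.length_cons, List.length_nil, Nat.reduceAdd] at this
    simp only [ha, hb, hc, and_true, and_false, or_true, or_false, if_true, if_false]
    linarith
  -- The four pairs form the cycle `a, b, c, b'`, from which one edge is dropped.
  · have := bound [(c, b), (b, a), (a, b')]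
      (by simp [ha, hb, hc]) (by simp; grind)
    simp only [List.length_cons, List.length_nil, Nat.reduceAdd] at this
    simp only [ha, hb, hc, and_true, and_false, or_true, or_false, if_true, if_false]
    linarith
  · have := bound [(c, b), (c', b'), (b, a), (a, b')]
      (by simp [ha, hb, hc]) (by simp; grind)
    simp only [List.length_cons, List.length_nil, Nat.reduceAdd] at this
    simp only [ha, hb, hc, and_true, and_false, or_true, or_false, if_true, if_false]
    nlinarith [mul_le_mul_of_nonneg_right this (pow_nonneg hq 6)]
  · have := bound [(a, b), (c, b), (a', b)]
      (by simp [ha, hb, hc]) (by simp; grind)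
    simp only [List.length_cons, List.length_nil, Nat.reduceAdd] at this
    simp only [ha, hb, hc, and_true, and_false, or_true, or_false, if_true, if_false]
    linarith
  · have := bound [(a, b), (c, b), (a', b'), (c', b')]
      (by simp [ha, hb, hc]) (by simp; grind)
    simp only [List.length_cons, List.length_nil, Nat.reduceAdd] at this
    simp only [ha, hb, hc, and_true, and_false, or_true, or_false, if_true, if_false]
    nlinarith [mul_le_mul_of_nonneg_right this (pow_nonneg hq 6)]
  · have := bound [(a, b), (a', b'), (b, c), (c, b')]
      (by simp [ha, hb, hc]) (by simp; grind)
    simp only [List.length_cons, List.length_nil, Nat.reduceAdd] at this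
    simp only [ha, hb, hc, and_true, and_false, or_true, or_false, if_true, if_false]
    nlinarith [mul_le_mul_of_nonneg_right this (pow_nonneg hq 6)]
  · have := bound [(a, b), (c, b), (a', b'), (c', b')]
      (by simp [ha, hb, hc]) (by simp; grind)
    simp only [List.length_cons, List.length_nil, Nat.reduceAdd] at this
    simp only [ha, hb, hc, and_true, and_false, or_true, or_false, if_true, if_false]
    nlinarith [mul_le_mul_of_nonneg_right this (pow_nonneg hq 6)]
end SecondMoment

/-! ### Localized triples and their conditional moments given the positions -/

section LocalizedTriangles

variable {d k n : ℕ}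

/-- The indicator of `closeSet ρ l`. -/
def closeInd (ρ : ℝ) (l : List (Fin k × Fin k)) : (Fin k → UnitAddTorus (Fin d)) → ℝ :=
  (closeSet ρ l).indicator 1

lemma closeInd_append (ρ : ℝ) (l l' : List (Fin k × Fin k)) (x : Fin k → UnitAddTorus (Fin d)) :
    closeInd ρ (l ++ l') x = closeInd ρ l x * closeInd ρ l' x := by
  have : (closeSet ρ (l ++ l') : Set (Fin k → UnitAddTorus (Fin d))) =
      closeSet ρ l ∩ closeSet ρ l' := by
    ext x
    simp only [closeSet, List.mem_append, or_imp, forall_and, Set.mem_inter_iff, Set.mem_ofPred_eq]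
  rw [closeInd, this, Set.inter_indicator_one]
  rfl

lemma integrable_closeInd (ρ : ℝ) (l : List (Fin k × Fin k)) :
    Integrable (closeInd ρ l : (Fin k → UnitAddTorus (Fin d)) → ℝ) :=
  (integrable_const (1 : ℝ)).indicator (measurableSet_closeSet ρ l)

lemma integral_closeInd (ρ : ℝ) (l : List (Fin k × Fin k)) :
    ∫ x, (closeInd ρ l : (Fin k → UnitAddTorus (Fin d)) → ℝ) x =
      volume.real (closeSet ρ l : Set (Fin k → UnitAddTorus (Fin d))) :=
  integral_indicator_one (measurableSet_closeSet ρ l)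

lemma closeInd_nonneg (ρ : ℝ) (l : List (Fin k × Fin k)) (x : Fin k → UnitAddTorus (Fin d)) :
    0 ≤ closeInd ρ l x :=
  Set.indicator_nonneg (fun _ _ => zero_le_one) x

open Classical in
/-- The indicator that the triple `t` of community vertices forms a triangle. -/
def triInd (hk : k ≤ n) (G : SimpleGraph (Fin n)) (t : Fin k × Fin k × Fin k) : ℝ :=
  if IsTri G (Fin.castLE hk t.1) (Fin.castLE hk t.2.1) (Fin.castLE hk t.2.2) then 1 else 0

/-- The number of triangles of `G` among the triples in `J` that are localized. -/
def localTriangles (hk : k ≤ n) (ρ : ℝ) (J : Finset (Fin k × Fin k × Fin k))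
    (x : Fin k → UnitAddTorus (Fin d)) (G : SimpleGraph (Fin n)) : ℝ :=
  ∑ t ∈ J, closeInd ρ (starPairs t) x * triInd hk G t

lemma triInd_nonneg (hk : k ≤ n) (G : SimpleGraph (Fin n)) (t : Fin k × Fin k × Fin k) :
    0 ≤ triInd hk G t := by
  unfold triInd
  split_ifs <;> norm_num

lemma triInd_le_one (hk : k ≤ n) (G : SimpleGraph (Fin n)) (t : Fin k × Fin k × Fin k) :
    triInd hk G t ≤ 1 := by
  unfold triInd
  split_ifs <;> norm_num

lemma localTriangles_le (hk : k ≤ n) (ρ : ℝ) (J : Finset (Fin k × Fin k × Fin k))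
    (x : Fin k → UnitAddTorus (Fin d)) (G : SimpleGraph (Fin n)) :
    localTriangles hk ρ J x G ≤ ∑ t ∈ J, triInd hk G t := by
  refine Finset.sum_le_sum fun t _ => mul_le_of_le_one_left (triInd_nonneg hk G t) ?_
  exact Set.indicator_le_self' (fun _ _ => zero_le_one) x

variable {γ : ℝ≥0∞} {μ w₀ ρ : ℝ} {w : Fin n → ℝ} {x : Fin k → UnitAddTorus (Fin d)}

/-- All pairs of a localized triple of vertices of weight at least `w₀` are joined with the
maximal probability. -/
lemma altEdge_of_mem_closeSet (hk : k ≤ n) (hμ : 0 ≤ μ) (hw₀ : 0 ≤ w₀) (hρ : 0 ≤ ρ)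
    (hball : μ * k * (2 * ρ) ^ d ≤ w₀ ^ 2) {a b c : Fin k}
    (ha : w₀ ≤ w (Fin.castLE hk a)) (hb : w₀ ≤ w (Fin.castLE hk b))
    (hc : w₀ ≤ w (Fin.castLE hk c)) (hx : x ∈ closeSet ρ (starPairs (a, b, c))) :
    altEdge d γ μ k w x (Fin.castLE hk a) (Fin.castLE hk b) = 1 / (1 + corrConst d γ) ∧
    altEdge d γ μ k w x (Fin.castLE hk b) (Fin.castLE hk c) = 1 / (1 + corrConst d γ) ∧
    altEdge d γ μ k w x (Fin.castLE hk c) (Fin.castLE hk a) = 1 / (1 + corrConst d γ) := by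
  have hab : ‖x a - x b‖ ≤ ρ := hx (a, b) (by simp [starPairs])
  have hcb : ‖x c - x b‖ ≤ ρ := hx (c, b) (by simp [starPairs])
  -- Closeness of the third pair is not imposed, which keeps the constraints a tree; the triangle
  -- inequality supplies it at distance `2 * ρ`, the radius in `hball`.
  have hca : ‖x c - x a‖ ≤ 2 * ρ := by
    have := norm_sub_le (x c - x b) (x a - x b)
    rw [sub_sub_sub_cancel_right] at this
    linarith
  have key : ∀ i j : Fin k, w₀ ≤ w (Fin.castLE hk i) → w₀ ≤ w (Fin.castLE hk j) →
      ‖x i - x j‖ ≤ 2 * ρ →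
      altEdge d γ μ k w x (Fin.castLE hk i) (Fin.castLE hk j) = 1 / (1 + corrConst d γ) := by
    intro i j hi hj hij
    refine altEdge_castLE hk hμ ?_
    calc μ * k * ‖x i - x j‖ ^ d ≤ μ * k * (2 * ρ) ^ d := by gcongr
      _ ≤ w₀ ^ 2 := hball
      _ ≤ _ := by rw [sq]; exact mul_le_mul hi hj hw₀ (hw₀.trans hi)
  refine ⟨key a b ha hb (by linarith), key b c hb hc ?_, key c a hc ha hca⟩
  rw [norm_sub_rev]
  linarith

/-- On the closeness event the three edge probabilities are constant, and off it both sides vanish.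
The conditional mean thus depends on the positions only through an indicator. -/
lemma sum_graphMass_closeInd_mul_triInd (hk : k ≤ n) (hμ : 0 ≤ μ) (hw₀ : 0 ≤ w₀) (hρ : 0 ≤ ρ)
    (hball : μ * k * (2 * ρ) ^ d ≤ w₀ ^ 2) {a b c : Fin k}
    (ha : w₀ ≤ w (Fin.castLE hk a)) (hb : w₀ ≤ w (Fin.castLE hk b))
    (hc : w₀ ≤ w (Fin.castLE hk c)) (hab : a ≠ b) (hac : a ≠ c) (hbc : b ≠ c) :
    ∑ G, graphMass (altEdge d γ μ k w x) G *
        (closeInd ρ (starPairs (a, b, c)) x * triInd hk G (a, b, c)) =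
      closeInd ρ (starPairs (a, b, c)) x * (1 / (1 + corrConst d γ)) ^ 3 := by
  classical
  simp only [mul_left_comm _ (closeInd ρ (starPairs (a, b, c)) x)]
  rw [← Finset.mul_sum]
  by_cases hx : x ∈ closeSet ρ (starPairs (a, b, c))
  · obtain ⟨h1, h2, h3⟩ := altEdge_of_mem_closeSet (γ := γ) hk hμ hw₀ hρ hball ha hb hc hx
    have hinj := Fin.castLE_injective hk
    have := sum_graphMass_isTri (altEdge_comm (d := d) (γ := γ) (μ := μ) (w := w) (x := x))
      (hinj.ne hab) (hinj.ne hbc) (hinj.ne hac.symm)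
    simp only [triInd]
    rw [this, h1, h2, h3]
    ring
  · have : closeInd ρ (starPairs (a, b, c)) x = 0 := Set.indicator_of_notMem hx _
    rw [this, zero_mul, zero_mul]

/-- Triples with two common vertices share an edge, and the product of triangle indicators is just
bounded by `1`. Otherwise the triangles are edge-disjoint, hence conditionally independent. -/
lemma sum_graphMass_closeInd_mul_triInd_sq_le (hk : k ≤ n) (hμ : 0 ≤ μ) (hw₀ : 0 ≤ w₀)
    (hw : ∀ i, 0 < w i) (hρ : 0 ≤ ρ)
    (hball : μ * k * (2 * ρ) ^ d ≤ w₀ ^ 2) {a b c a' b' c' : Fin k}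
    (ha : w₀ ≤ w (Fin.castLE hk a)) (hb : w₀ ≤ w (Fin.castLE hk b))
    (hc : w₀ ≤ w (Fin.castLE hk c))
    (ha' : w₀ ≤ w (Fin.castLE hk a')) (hb' : w₀ ≤ w (Fin.castLE hk b'))
    (hc' : w₀ ≤ w (Fin.castLE hk c'))
    (hab : a ≠ b) (hac : a ≠ c) (hbc : b ≠ c)
    (hab' : a' ≠ b') (hac' : a' ≠ c') (hbc' : b' ≠ c')
    (h1 : a ≠ b') (h2 : a ≠ c') (h3 : b ≠ a') (h4 : b ≠ c') (h5 : c ≠ a') (h6 : c ≠ b') :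
    ∑ G, graphMass (altEdge d γ μ k w x) G *
        ((closeInd ρ (starPairs (a, b, c)) x * triInd hk G (a, b, c)) *
        (closeInd ρ (starPairs (a', b', c')) x * triInd hk G (a', b', c'))) ≤
      closeInd ρ (starPairs (a, b, c) ++ starPairs (a', b', c')) x *
      (if (a = a' ∧ b = b') ∨ (a = a' ∧ c = c') ∨ (b = b' ∧ c = c') then 1
        else (1 / (1 + corrConst d γ)) ^ 6) := by
  classical
  have hm := graphMass_nonneg (altEdge_nonneg (d := d) (γ := γ) (k := k) (x := x) hμ hw)
    (altEdge_le_one hμ hw)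
  have hre : ∀ G, graphMass (altEdge d γ μ k w x) G *
        ((closeInd ρ (starPairs (a, b, c)) x * triInd hk G (a, b, c)) *
        (closeInd ρ (starPairs (a', b', c')) x * triInd hk G (a', b', c'))) =
      closeInd ρ (starPairs (a, b, c) ++ starPairs (a', b', c')) x *
        (graphMass (altEdge d γ μ k w x) G *
        (triInd hk G (a, b, c) * triInd hk G (a', b', c'))) := by
    intro G
    rw [closeInd_append]
    ring
  rw [Finset.sum_congr rfl fun G _ => hre G, ← Finset.mul_sum]
  split_ifs with h
  · refine mul_le_mul_of_nonneg_left ?_ (closeInd_nonneg _ _ _)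
    rw [← sum_graphMass (altEdge d γ μ k w x)]
    refine Finset.sum_le_sum fun G _ => mul_le_of_le_one_right (hm G) ?_
    exact mul_le_one₀ (triInd_le_one _ _ _) (triInd_nonneg _ _ _) (triInd_le_one _ _ _)
  · push Not at h
    rw [closeInd_append]
    by_cases hx : x ∈ closeSet ρ (starPairs (a, b, c))
    · by_cases hx' : x ∈ closeSet ρ (starPairs (a', b', c'))
      · obtain ⟨e1, e2, e3⟩ := altEdge_of_mem_closeSet (γ := γ) hk hμ hw₀ hρ hball ha hb hc hx
        obtain ⟨f1, f2, f3⟩ := altEdge_of_mem_closeSet (γ := γ) hk hμ hw₀ hρ hball ha' hb' hc' hx'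
        have hinj := Fin.castLE_injective hk
        have := sum_graphMass_isTri_isTri
          (altEdge_comm (d := d) (γ := γ) (μ := μ) (w := w) (x := x))
          (hinj.ne hab) (hinj.ne hbc) (hinj.ne hac.symm)
          (hinj.ne hab') (hinj.ne hbc') (hinj.ne hac'.symm)
          (disjoint_triPairs (hinj.ne h1) (hinj.ne h2) (hinj.ne h3) (hinj.ne h4) (hinj.ne h5)
            (hinj.ne h6) (fun e => hinj.ne (h.1 (hinj e)))
            (fun e => hinj.ne (h.2.1 (hinj e))) (fun e => hinj.ne (h.2.2 (hinj e))))
        simp only [triInd]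
        rw [this, e1, e2, e3, f1, f2, f3]
        exact le_of_eq (by ring)
      · have : closeInd ρ (starPairs (a', b', c')) x = 0 := Set.indicator_of_notMem hx' _
        simp [this]
    · have : closeInd ρ (starPairs (a, b, c)) x = 0 := Set.indicator_of_notMem hx _
      simp [this]

end LocalizedTriangles

/-! ### Variance and Chebyshev's inequality for localized triangles -/

section Chebyshev

variable {d k n m : ℕ}

/-- The number of pairs of triples that share two prescribed coordinates. -/
lemma sum_sum_ite_le {J : Finset (Fin k × Fin k × Fin k)} (S : Finset (Fin k))
    (r : (Fin k × Fin k × Fin k) → (Fin k × Fin k × Fin k) → Prop) [∀ t t', Decidable (r t t')]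
    (g : (Fin k × Fin k × Fin k) → Fin k) (hg : ∀ t ∈ J, g t ∈ S)
    (hr : ∀ t ∈ J, ∀ t₁ ∈ J, ∀ t₂ ∈ J, r t t₁ → r t t₂ → g t₁ = g t₂ → t₁ = t₂)
    {u : ℝ} (hu : 0 ≤ u) :
    ∑ t ∈ J, ∑ t' ∈ J, (if r t t' then u else 0) ≤ J.card * (S.card * u) := by
  rw [← nsmul_eq_mul]
  refine Finset.sum_le_card_nsmul _ _ _ fun t ht => ?_
  rw [← Finset.sum_filter, Finset.sum_const, nsmul_eq_mul]
  refine mul_le_mul_of_nonneg_right ?_ hu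
  -- For fixed `t`, a related `t'` is determined by its one free coordinate `g t'`.
  refine Nat.cast_le.2 (Finset.card_le_card_of_injOn g (fun t' h => ?_) ?_)
  · exact hg t' (Finset.mem_filter.1 h).1
  · intro t₁ h₁ t₂ h₂ h
    have h₁' := Finset.mem_filter.1 h₁
    have h₂' := Finset.mem_filter.1 h₂
    exact hr t ht t₁ h₁'.1 t₂ h₂'.1 h₁'.2 h₂'.2 h

variable {γ : ℝ≥0∞} {μ w₀ ρ : ℝ} {w : Fin n → ℝ}

/-- The variance of the number of localized triangles. -/
lemma exists_variance_bound (hk : k ≤ n) (hμ : 0 ≤ μ) (hw₀ : 0 ≤ w₀)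
    (hw : ∀ i, 0 < w i) (hρ : 0 ≤ ρ) (hρ' : 2 * ρ ≤ 1)
    (hball : μ * k * (2 * ρ) ^ d ≤ w₀ ^ 2) {S₁ S₂ S₃ : Finset (Fin k)}
    (h₁₂ : Disjoint S₁ S₂) (h₁₃ : Disjoint S₁ S₃) (h₂₃ : Disjoint S₂ S₃)
    (hc₁ : S₁.card = m) (hc₂ : S₂.card = m) (hc₃ : S₃.card = m)
    (hS₁ : ∀ a ∈ S₁, w₀ ≤ w (Fin.castLE hk a)) (hS₂ : ∀ a ∈ S₂, w₀ ≤ w (Fin.castLE hk a))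
    (hS₃ : ∀ a ∈ S₃, w₀ ≤ w (Fin.castLE hk a)) {e : ℝ}
    (he : e = m ^ 3 * ((2 * ρ) ^ d) ^ 2 * (1 / (1 + corrConst d γ)) ^ 3) :
    ∃ g : (Fin k → UnitAddTorus (Fin d)) → ℝ, Integrable g ∧
      (∀ x, ∑ G, graphMass (altEdge d γ μ k w x) G *
        (localTriangles hk ρ (S₁ ×ˢ S₂ ×ˢ S₃) x G - e) ^ 2 ≤ g x) ∧
      ∫ x, g x ≤ 3 * m ^ 4 * ((2 * ρ) ^ d) ^ 3 + m ^ 3 * ((2 * ρ) ^ d) ^ 2 := by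
  classical
  set J := S₁ ×ˢ S₂ ×ˢ S₃ with hJ
  set q : ℝ := 1 / (1 + corrConst d γ) with hq
  have hq0 : 0 ≤ q := by
    have := corrConst_nonneg d γ
    positivity
  have hcJ : (J.card : ℝ) = m ^ 3 := by
    rw [hJ, Finset.card_product, Finset.card_product, hc₁, hc₂, hc₃]
    push_cast
    ring
  have hmem : ∀ t ∈ J, t.1 ∈ S₁ ∧ t.2.1 ∈ S₂ ∧ t.2.2 ∈ S₃ := by
    intro t ht
    simpa [hJ] using ht
  have hne₁₂ : ∀ a ∈ S₁, ∀ b ∈ S₂, a ≠ b := fun a ha b hb => Finset.disjoint_iff_ne.1 h₁₂ a ha b hb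
  have hne₁₃ : ∀ a ∈ S₁, ∀ b ∈ S₃, a ≠ b := fun a ha b hb => Finset.disjoint_iff_ne.1 h₁₃ a ha b hb
  have hne₂₃ : ∀ a ∈ S₂, ∀ b ∈ S₃, a ≠ b := fun a ha b hb => Finset.disjoint_iff_ne.1 h₂₃ a ha b hb
  let c : (Fin k × Fin k × Fin k) → (Fin k × Fin k × Fin k) → ℝ := fun t t' =>
    if (t.1 = t'.1 ∧ t.2.1 = t'.2.1) ∨ (t.1 = t'.1 ∧ t.2.2 = t'.2.2) ∨
      (t.2.1 = t'.2.1 ∧ t.2.2 = t'.2.2) then 1 else q ^ 6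
  -- The square around `e` is expanded and only the pair terms are estimated. What remains is a
  -- finite combination of closeness indicators, integrable with explicit integral.
  refine ⟨fun x => ∑ t ∈ J, ∑ t' ∈ J, closeInd ρ (starPairs t ++ starPairs t') x * c t t' -
    2 * e * ∑ t ∈ J, closeInd ρ (starPairs t) x * q ^ 3 + e ^ 2, ?_, ?_, ?_⟩
  · have h1 := fun t t' => (integrable_closeInd (d := d) ρ (starPairs t ++ starPairs t')).mul_const
      (c t t')
    have h2 := fun t => (integrable_closeInd (d := d) ρ (starPairs t : List (Fin k × Fin k))).mul_const
      (q ^ 3)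
    exact ((integrable_finsetSum _ fun t _ => integrable_finsetSum _ fun t' _ => h1 t t').sub
      ((integrable_finsetSum _ fun t _ => h2 t).const_mul _)).add (integrable_const _)
  · intro x
    have hexp : ∀ G, graphMass (altEdge d γ μ k w x) G * (localTriangles hk ρ J x G - e) ^ 2 =
        ∑ t ∈ J, ∑ t' ∈ J, graphMass (altEdge d γ μ k w x) G *
          ((closeInd ρ (starPairs t) x * triInd hk G t) *
            (closeInd ρ (starPairs t') x * triInd hk G t')) -
        2 * e * ∑ t ∈ J, graphMass (altEdge d γ μ k w x) G *
          (closeInd ρ (starPairs t) x * triInd hk G t) +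
        e ^ 2 * graphMass (altEdge d γ μ k w x) G := by
      intro G
      simp only [← Finset.mul_sum]
      simp only [← Finset.sum_mul]
      rw [← localTriangles]
      ring
    rw [Finset.sum_congr rfl fun G _ => hexp G, Finset.sum_add_distrib, Finset.sum_sub_distrib,
      ← Finset.mul_sum, ← Finset.mul_sum, sum_graphMass, mul_one]
    refine add_le_add_left (sub_le_sub ?_ (le_of_eq ?_)) _
    · rw [Finset.sum_comm]
      refine Finset.sum_le_sum fun t ht => ?_
      rw [Finset.sum_comm]
      refine Finset.sum_le_sum fun t' ht' => ?_
      obtain ⟨ha, hb, hc⟩ := hmem t ht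
      obtain ⟨ha', hb', hc'⟩ := hmem t' ht'
      exact sum_graphMass_closeInd_mul_triInd_sq_le hk hμ hw₀ hw hρ hball (hS₁ _ ha) (hS₂ _ hb)
        (hS₃ _ hc) (hS₁ _ ha') (hS₂ _ hb') (hS₃ _ hc') (hne₁₂ _ ha _ hb) (hne₁₃ _ ha _ hc)
        (hne₂₃ _ hb _ hc) (hne₁₂ _ ha' _ hb') (hne₁₃ _ ha' _ hc') (hne₂₃ _ hb' _ hc')
        (hne₁₂ _ ha _ hb') (hne₁₃ _ ha _ hc') (hne₁₂ _ ha' _ hb).symm (hne₂₃ _ hb _ hc')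
        (hne₁₃ _ ha' _ hc).symm (hne₂₃ _ hb' _ hc).symm
    · rw [Finset.sum_comm]
      refine congrArg _ (Finset.sum_congr rfl fun t ht => ?_)
      obtain ⟨ha, hb, hc⟩ := hmem t ht
      exact (sum_graphMass_closeInd_mul_triInd hk hμ hw₀ hρ hball (hS₁ _ ha) (hS₂ _ hb)
        (hS₃ _ hc) (hne₁₂ _ ha _ hb) (hne₁₃ _ ha _ hc) (hne₂₃ _ hb _ hc)).symm
  · have h1 := fun t t' => (integrable_closeInd (d := d) ρ (starPairs t ++ starPairs t')).mul_const
      (c t t')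
    have h2 := fun t => (integrable_closeInd (d := d) ρ (starPairs t : List (Fin k × Fin k))).mul_const
      (q ^ 3)
    rw [integral_add, integral_sub, integral_const_mul, integral_finsetSum, integral_finsetSum,
      integral_const, probReal_univ, one_smul]
    rotate_left
    · exact fun t _ => h2 t
    · exact fun t _ => integrable_finsetSum _ fun t' _ => h1 t t'
    · exact integrable_finsetSum _ fun t _ => integrable_finsetSum _ fun t' _ => h1 t t'
    · exact (integrable_finsetSum _ fun t _ => h2 t).const_mul _
    · exact ((integrable_finsetSum _ fun t _ => integrable_finsetSum _ fun t' _ => h1 t t').sub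
        ((integrable_finsetSum _ fun t _ => h2 t).const_mul _))
    · exact integrable_const _
    have hfirst : ∑ t ∈ J, ∫ x, (closeInd ρ (starPairs t) : (Fin k → UnitAddTorus (Fin d)) → ℝ) x *
        q ^ 3 = e := by
      rw [he, ← hcJ, mul_assoc, ← nsmul_eq_mul, ← Finset.sum_const]
      refine Finset.sum_congr rfl fun t ht => ?_
      obtain ⟨ha, hb, hc⟩ := hmem t ht
      rw [integral_mul_const, integral_closeInd, measureReal_closeSet hρ hρ']
      · rfl
      · simpa [starPairs] using ⟨hne₁₂ _ ha _ hb, (hne₂₃ _ hb _ hc).symm⟩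
      · simpa [starPairs] using ⟨(hne₁₃ _ ha _ hc).symm, (hne₁₂ _ ha _ hb).symm⟩
    have hsecond : ∑ t ∈ J, ∫ x, ∑ t' ∈ J,
        (closeInd ρ (starPairs t ++ starPairs t') : (Fin k → UnitAddTorus (Fin d)) → ℝ) x * c t t' ≤
        e ^ 2 + 3 * m ^ 4 * ((2 * ρ) ^ d) ^ 3 + m ^ 3 * ((2 * ρ) ^ d) ^ 2 := by
      have hv : 0 ≤ (2 * ρ) ^ d := by positivity
      calc _ ≤ ∑ t ∈ J, ∑ t' ∈ J, (((2 * ρ) ^ d) ^ 4 * q ^ 6 +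
            (if t.1 = t'.1 ∧ t.2.1 = t'.2.1 then ((2 * ρ) ^ d) ^ 3 else 0) +
            (if t.1 = t'.1 ∧ t.2.2 = t'.2.2 then ((2 * ρ) ^ d) ^ 3 else 0) +
            (if t.2.1 = t'.2.1 ∧ t.2.2 = t'.2.2 then ((2 * ρ) ^ d) ^ 3 else 0) +
            (if t.1 = t'.1 ∧ t.2.1 = t'.2.1 ∧ t.2.2 = t'.2.2 then ((2 * ρ) ^ d) ^ 2 else 0)) := by
            refine Finset.sum_le_sum fun t ht => ?_
            rw [integral_finsetSum _ fun t' _ => h1 t t']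
            refine Finset.sum_le_sum fun t' ht' => ?_
            rw [integral_mul_const, integral_closeInd]
            obtain ⟨ha, hb, hc⟩ := hmem t ht
            obtain ⟨ha', hb', hc'⟩ := hmem t' ht'
            exact measureReal_closeSet_starPairs_mul_le hρ hρ' hq0 (hne₁₂ _ ha _ hb)
              (hne₁₃ _ ha _ hc) (hne₂₃ _ hb _ hc) (hne₁₂ _ ha' _ hb') (hne₁₃ _ ha' _ hc')
              (hne₂₃ _ hb' _ hc') (hne₁₂ _ ha _ hb') (hne₁₃ _ ha _ hc') (hne₁₂ _ ha' _ hb).symm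
              (hne₂₃ _ hb _ hc') (hne₁₃ _ ha' _ hc).symm (hne₂₃ _ hb' _ hc).symm
        _ ≤ J.card * (J.card * (((2 * ρ) ^ d) ^ 4 * q ^ 6)) +
            J.card * (S₃.card * ((2 * ρ) ^ d) ^ 3) + J.card * (S₂.card * ((2 * ρ) ^ d) ^ 3) +
            J.card * (S₁.card * ((2 * ρ) ^ d) ^ 3) +
            J.card * ((2 * ρ) ^ d) ^ 2 := by
            simp only [Finset.sum_add_distrib, Finset.sum_const, nsmul_eq_mul]
            refine add_le_add (add_le_add (add_le_add (add_le_add le_rfl ?_) ?_) ?_) ?_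
            · refine sum_sum_ite_le S₃ _ (fun t => t.2.2) (fun t ht => (hmem t ht).2.2) ?_
                (by positivity)
              rintro t - t₁ - t₂ - ⟨ha, hb⟩ ⟨ha', hb'⟩ h
              exact Prod.ext (ha.symm.trans ha') (Prod.ext (hb.symm.trans hb') h)
            · refine sum_sum_ite_le S₂ _ (fun t => t.2.1) (fun t ht => (hmem t ht).2.1) ?_
                (by positivity)
              rintro t - t₁ - t₂ - ⟨ha, hb⟩ ⟨ha', hb'⟩ h
              exact Prod.ext (ha.symm.trans ha') (Prod.ext h (hb.symm.trans hb'))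
            · refine sum_sum_ite_le S₁ _ (fun t => t.1) (fun t ht => (hmem t ht).1) ?_
                (by positivity)
              rintro t - t₁ - t₂ - ⟨ha, hb⟩ ⟨ha', hb'⟩ h
              exact Prod.ext h (Prod.ext (ha.symm.trans ha') (hb.symm.trans hb'))
            · rw [← nsmul_eq_mul]
              refine Finset.sum_le_card_nsmul _ _ _ fun t ht => le_of_eq ?_
              rw [Finset.sum_eq_single_of_mem t ht]
              · simp
              · rintro t' - hne
                exact if_neg fun h => hne (Prod.ext h.1 (Prod.ext h.2.1 h.2.2)).symm
        _ = _ := by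
            rw [hc₁, hc₂, hc₃, hcJ, he]
            ring
    -- The main term `e ^ 2` of the second moment cancels against `- 2 * e * e + e ^ 2`; only pairs
    -- with two or three common vertices survive.
    rw [hfirst]
    nlinarith [hsecond]

/-- The triangles with vertices in disjoint sets of community vertices of weight at most `M`. -/
lemma sum_triInd_le_weightedTriangles (hk : k ≤ n) (hw : ∀ i, 0 < w i) {M : ℝ}
    {S₁ S₂ S₃ : Finset (Fin k)}
    (hS₁ : ∀ a ∈ S₁, w (Fin.castLE hk a) ≤ M) (hS₂ : ∀ a ∈ S₂, w (Fin.castLE hk a) ≤ M)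
    (hS₃ : ∀ a ∈ S₃, w (Fin.castLE hk a) ≤ M) (G : SimpleGraph (Fin n)) :
    (∑ t ∈ S₁ ×ˢ S₂ ×ˢ S₃, triInd hk G t) / M ^ 3 ≤ weightedTriangles w G := by
  classical
  have hsub : ∀ (S : Finset (Fin k)) (F : Fin n → ℝ), (∀ i, 0 ≤ F i) →
      ∑ a ∈ S, F (Fin.castLE hk a) ≤ ∑ i, F i := by
    intro S F hF
    have := Finset.sum_map S (Fin.castLEEmb hk) F
    simp only [Fin.castLEEmb_apply] at this
    rw [← this]
    exact Finset.sum_le_sum_of_subset_of_nonneg (Finset.subset_univ _) fun i _ _ => hF i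
  rw [weightedTriangles_eq, Finset.sum_product, Finset.sum_div]
  have hpos : ∀ a b c : Fin n, (0 : ℝ) ≤
      (if IsTri G a b c then 1 else 0) * (1 / (w a * w b * w c)) := by
    intro a b c
    have := hw a
    have := hw b
    have := hw c
    split_ifs <;> positivity
  refine le_trans (Finset.sum_le_sum fun a ha => ?_) (hsub S₁ _ fun a =>
    Finset.sum_nonneg fun b _ => Finset.sum_nonneg fun c _ => hpos a b c)
  rw [Finset.sum_product, Finset.sum_div]
  refine le_trans (Finset.sum_le_sum fun b hb => ?_) (hsub S₂ _ fun b =>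
    Finset.sum_nonneg fun c _ => hpos _ b c)
  rw [Finset.sum_div]
  refine le_trans (Finset.sum_le_sum fun c hc => ?_) (hsub S₃ _ fun c => hpos _ _ c)
  rw [div_eq_mul_one_div]
  refine mul_le_mul_of_nonneg_left ?_ (triInd_nonneg _ _ _)
  have h1 := hw (Fin.castLE hk a)
  have h2 := hw (Fin.castLE hk b)
  have h3 := hw (Fin.castLE hk c)
  refine one_div_le_one_div_of_le (by positivity) ?_
  rw [pow_three']
  exact mul_le_mul (mul_le_mul (hS₁ a ha) (hS₂ b hb) h2.le (h1.le.trans (hS₁ a ha))) (hS₃ c hc)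
    h3.le (mul_nonneg (h1.le.trans (hS₁ a ha)) (h2.le.trans (hS₂ b hb)))

/-- The type-II error of the weighted triangle test. -/
lemma altProb_weightedTriangles_lt_le (hk : k ≤ n) (hμ : 0 ≤ μ) (hw₀ : 0 ≤ w₀)
    (hw : ∀ i, 0 < w i) (hρ : 0 ≤ ρ) (hρ' : 2 * ρ ≤ 1)
    (hball : μ * k * (2 * ρ) ^ d ≤ w₀ ^ 2) {S₁ S₂ S₃ : Finset (Fin k)}
    (h₁₂ : Disjoint S₁ S₂) (h₁₃ : Disjoint S₁ S₃) (h₂₃ : Disjoint S₂ S₃)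
    (hc₁ : S₁.card = m) (hc₂ : S₂.card = m) (hc₃ : S₃.card = m) {M : ℝ} (hM : 0 < M)
    (hS : ∀ a ∈ S₁ ∪ S₂ ∪ S₃, w₀ ≤ w (Fin.castLE hk a) ∧ w (Fin.castLE hk a) ≤ M)
    {e f : ℝ} (he : e = m ^ 3 * ((2 * ρ) ^ d) ^ 2 * (1 / (1 + corrConst d γ)) ^ 3)
    (he0 : 0 < e) (hf : M ^ 3 * f ≤ e / 2) :
    altProb d γ μ k w {G | weightedTriangles w G < f} ≤
      (3 * m ^ 4 * ((2 * ρ) ^ d) ^ 3 + m ^ 3 * ((2 * ρ) ^ d) ^ 2) / (e / 2) ^ 2 := by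
  classical
  have hS₁ := fun a (ha : a ∈ S₁) => hS a (by simp [ha])
  have hS₂ := fun a (ha : a ∈ S₂) => hS a (by simp [ha])
  have hS₃ := fun a (ha : a ∈ S₃) => hS a (by simp [ha])
  obtain ⟨g, hg, hle, hint⟩ := exists_variance_bound (d := d) (γ := γ) hk hμ hw₀ hw hρ hρ' hball
    h₁₂ h₁₃ h₂₃ hc₁ hc₂ hc₃ (fun a ha => (hS₁ a ha).1) (fun a ha => (hS₂ a ha).1)
    (fun a ha => (hS₃ a ha).1) he
  refine le_trans ?_ (div_le_div_of_nonneg_right hint (by positivity))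
  rw [← integral_div]
  unfold altProb
  have hm := fun x : Fin k → UnitAddTorus (Fin d) =>
    graphMass_nonneg (altEdge_nonneg (d := d) (γ := γ) (k := k) (x := x) hμ hw)
    (altEdge_le_one hμ hw)
  -- Only the dominating function has to be integrable, so measurability of the graph probabilities
  -- in the positions is not needed.
  refine integral_mono_of_nonneg (.of_forall fun x => Finset.sum_nonneg fun G _ => hm x G)
    (hg.div_const _) (.of_forall fun x => ?_)
  refine le_trans ?_ (div_le_div_of_nonneg_right (hle x) (by positivity))
  unfold graphProb
  rw [Finset.sum_div]
  refine (Finset.sum_le_sum fun G hG => ?_).trans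
    (Finset.sum_le_sum_of_subset_of_nonneg (Finset.filter_subset _ _) fun G _ _ => ?_)
  -- On this event the localized count is at most $M^3W<M^3f\le e/2$, so it deviates from `e` by at
  -- least `e / 2`.
  · have hG' : weightedTriangles w G < f := by simpa using hG
    have h1 := sum_triInd_le_weightedTriangles hk hw (fun a ha => (hS₁ a ha).2)
      (fun a ha => (hS₂ a ha).2) (fun a ha => (hS₃ a ha).2) G
    rw [div_le_iff₀ (by positivity)] at h1
    have h2 := localTriangles_le hk ρ (S₁ ×ˢ S₂ ×ˢ S₃) x G
    have h3 : weightedTriangles w G * M ^ 3 < f * M ^ 3 :=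
      mul_lt_mul_of_pos_right hG' (by positivity)
    rw [le_div_iff₀ (by positivity)]
    refine mul_le_mul_of_nonneg_left ?_ (hm x G)
    rw [← neg_sq (_ - e)]
    exact pow_le_pow_left₀ (by positivity) (by linarith) 2
  · have := hm x G
    positivity

end Chebyshev

/-! ### Asymptotics -/

/-- The logarithm is beaten by the power $s/2$. It ensures that the fixed levels `w₀` and `6 * w₀`
eventually lie in the range of the power law. -/
lemma tendsto_cutoff {τ : ℝ} (hτ : 1 < τ) : Tendsto (cutoff τ) atTop atTop := by
  set s := 1 / (τ - 1) with hs
  have hs0 : 0 < s := by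
    have : 0 < τ - 1 := by linarith
    positivity
  have h1 : Tendsto (fun m : ℕ => s / 2 * (m : ℝ) ^ (s / 2)) atTop atTop :=
    ((tendsto_rpow_atTop (half_pos hs0)).comp tendsto_natCast_atTop_atTop).const_mul_atTop
      (half_pos hs0)
  refine tendsto_atTop_mono' _ ?_ h1
  filter_upwards [eventually_ge_atTop 2] with m hm
  have hm1 : (1 : ℝ) < m := by exact_mod_cast hm
  have hlog : 0 < Real.log m := Real.log_pos hm1
  rw [cutoff, ← hs, le_div_iff₀ hlog]
  calc s / 2 * (m : ℝ) ^ (s / 2) * Real.log m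
      ≤ s / 2 * (m : ℝ) ^ (s / 2) * ((m : ℝ) ^ (s / 2) / (s / 2)) := by
        gcongr
        exact Real.log_le_rpow_div (by linarith) (half_pos hs0)
    _ = (m : ℝ) ^ (s / 2) * (m : ℝ) ^ (s / 2) := by
        field_simp
    _ = (m : ℝ) ^ s := by
        rw [← Real.rpow_add (by linarith), add_halves]

lemma community_eq_map {n k : ℕ} (hk : k ≤ n) :
    community n k = Finset.univ.map (Fin.castLEEmb hk) := by
  ext i
  simp only [community, Finset.mem_filter, Finset.mem_univ, true_and, Finset.mem_map,
    Fin.castLEEmb_apply]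
  exact ⟨fun h => ⟨⟨i, h⟩, rfl⟩, by rintro ⟨a, rfl⟩; simp⟩

/-- A positive proportion of the community has weight of order one. -/
lemma card_moderate_weights_ge {τ C w₀ : ℝ} (hτ : 2 < τ) (hC : 0 < C) (hw₀ : 0 < w₀)
    {n k : ℕ} (hk : k ≤ n) {w : Fin n → ℝ} {b : ℝ} (hb : 6 * w₀ ≤ b)
    (htail : ∀ x, w₀ ≤ x → x ≤ b →
      |(1 - empiricalCDF w (community n k) x) - C * x ^ (1 - τ)| ≤ 1 / 2 * (C * x ^ (1 - τ))) :
    C * w₀ ^ (1 - τ) / 4 * k ≤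
      ((Finset.univ.filter fun a : Fin k =>
        w₀ < w (Fin.castLE hk a) ∧ w (Fin.castLE hk a) ≤ 6 * w₀).card : ℝ) := by
  have hcount : ∀ x, (k : ℝ) * (1 - empiricalCDF w (community n k) x) =
      (Finset.univ.filter fun a : Fin k => x < w (Fin.castLE hk a)).card := by
    intro x
    have h := card_mul_one_sub_empiricalCDF w (community n k) x
    rw [community_eq_map hk] at h ⊢
    rw [Finset.card_map, Finset.card_univ, Fintype.card_fin, Finset.filter_map,
      Finset.card_map] at h
    exact h
  have h1 := (abs_le.1 (htail w₀ le_rfl (by linarith))).1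
  have h2 := (abs_le.1 (htail (6 * w₀) (by linarith) hb)).2
  -- Source of the factor 6: as $\tau>2$, the tail at $6w_0$ is at most $\frac32\cdot\frac16$ of
  -- $Cw_0^{1-\tau}$, while the tail at $w_0$ is at least $\frac12$ of it, leaving $\frac14$.
  have hpow : (6 * w₀) ^ (1 - τ) ≤ 6⁻¹ * w₀ ^ (1 - τ) := by
    rw [Real.mul_rpow (by norm_num) hw₀.le]
    refine mul_le_mul_of_nonneg_right ?_ (by positivity)
    rw [← Real.rpow_neg_one]
    exact Real.rpow_le_rpow_of_exponent_le (by norm_num) (by linarith)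
  have hsplit : (Finset.univ.filter fun a : Fin k => w₀ < w (Fin.castLE hk a)).card =
      (Finset.univ.filter fun a : Fin k =>
        w₀ < w (Fin.castLE hk a) ∧ w (Fin.castLE hk a) ≤ 6 * w₀).card +
      (Finset.univ.filter fun a : Fin k => 6 * w₀ < w (Fin.castLE hk a)).card := by
    rw [← Finset.card_filter_add_card_filter_not (fun a : Fin k => w (Fin.castLE hk a) ≤ 6 * w₀),
      Finset.filter_filter, Finset.filter_filter]
    congr 2
    ext a
    simp only [Finset.mem_filter, Finset.mem_univ, true_and, not_le, and_iff_right_iff_imp]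
    intro h
    linarith
  have e1 := hcount w₀
  have e2 := hcount (6 * w₀)
  rw [hsplit, Nat.cast_add, ← e2] at e1
  have hpos : 0 < w₀ ^ (1 - τ) := by positivity
  have h3 : C * (6 * w₀) ^ (1 - τ) ≤ C * (6⁻¹ * w₀ ^ (1 - τ)) :=
    mul_le_mul_of_nonneg_left hpow hC.le
  have h4 : C * w₀ ^ (1 - τ) / 4 ≤ (1 - empiricalCDF w (community n k) w₀) -
      (1 - empiricalCDF w (community n k) (6 * w₀)) := by
    linarith
  have := mul_le_mul_of_nonneg_left h4 (Nat.cast_nonneg (α := ℝ) k)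
  linarith

/-- Disjoint ranges for the three positions mean that a vertex shared by two triples sits at the
same position in both. -/
lemma exists_three_disjoint_subsets {α : Type*} [DecidableEq α] {S : Finset α} {m : ℕ}
    (h : 3 * m ≤ S.card) :
    ∃ S₁ S₂ S₃ : Finset α, Disjoint S₁ S₂ ∧ Disjoint S₁ S₃ ∧ Disjoint S₂ S₃ ∧
      S₁.card = m ∧ S₂.card = m ∧ S₃.card = m ∧ S₁ ∪ S₂ ∪ S₃ ⊆ S := by
  obtain ⟨S₁, h₁, c₁⟩ := Finset.exists_subset_card_eq (by lia : m ≤ S.card)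
  have d₁ := Finset.card_sdiff_of_subset h₁
  obtain ⟨S₂, h₂, c₂⟩ := Finset.exists_subset_card_eq (by lia : m ≤ (S \ S₁).card)
  have d₂ := Finset.card_sdiff_of_subset h₂
  obtain ⟨S₃, h₃, c₃⟩ := Finset.exists_subset_card_eq (by lia : m ≤ ((S \ S₁) \ S₂).card)
  have h₃' := h₃.trans Finset.sdiff_subset
  refine ⟨S₁, S₂, S₃, ?_, ?_, ?_, c₁, c₂, c₃, ?_⟩
  · exact Finset.disjoint_of_subset_right h₂ Finset.disjoint_sdiff
  · exact Finset.disjoint_of_subset_right h₃' Finset.disjoint_sdiff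
  · exact Finset.disjoint_of_subset_right h₃ Finset.disjoint_sdiff
  · exact Finset.union_subset (Finset.union_subset h₁ (h₂.trans Finset.sdiff_subset))
      (h₃'.trans Finset.sdiff_subset)

/-- The type-II error is at most of order `1 / k`. -/
lemma altProb_weightedTriangles_lt_le_div {d : ℕ} (hd : 1 ≤ d) {γ : ℝ≥0∞} {μ w₀ c₀ M : ℝ}
    (hμ : 0 < μ) (hw₀ : 0 < w₀) (hc₀ : 0 < c₀) (hM : 0 < M) :
    ∃ ε > 0, ∃ D K : ℝ, ∀ (n k : ℕ) (hk : k ≤ n) (w : Fin n → ℝ) (f : ℝ), (∀ i, 0 < w i) →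
      K ≤ k → f ≤ ε * k →
      c₀ * k ≤ ((Finset.univ.filter fun a : Fin k =>
        w₀ < w (Fin.castLE hk a) ∧ w (Fin.castLE hk a) ≤ M).card : ℝ) →
      altProb d γ μ k w {G | weightedTriangles w G < f} ≤ D / k := by
  have hC₁ := corrConst_nonneg d γ
  set q : ℝ := 1 / (1 + corrConst d γ) with hq
  have hq0 : 0 < q := by positivity
  set l : ℝ := w₀ ^ 2 / μ with hl
  have hl0 : 0 < l := by positivity
  set β : ℝ := (c₀ / 6) ^ 3 * l ^ 2 * q ^ 3 with hβ
  have hβ0 : 0 < β := by positivity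
  -- Here `β * k` bounds the mean `e` from below, and `ε` makes `M ^ 3 * f ≤ β * k / 2`. The bound
  -- `l ≤ k` gives `2 * ρ ≤ 1`, and `4 / c₀ ≤ k` absorbs the rounding in `m = S.card / 3`.
  refine ⟨β / (2 * M ^ 3), by positivity, (3 * l ^ 3 + l ^ 2) / (β / 2) ^ 2,
    max 1 (max l (4 / c₀)), ?_⟩
  intro n k hk w f hw hK hf hcard
  have hk1 : (1 : ℝ) ≤ k := (le_max_left _ _).trans hK
  have hkl : l ≤ k := ((le_max_left _ _).trans (le_max_right _ _)).trans hK
  have hkc : 4 / c₀ ≤ k := ((le_max_right _ _).trans (le_max_right _ _)).trans hK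
  have hk0 : (0 : ℝ) < k := by linarith
  rw [div_le_iff₀ hc₀] at hkc
  set S := Finset.univ.filter fun a : Fin k =>
        w₀ < w (Fin.castLE hk a) ∧ w (Fin.castLE hk a) ≤ M with hS
  set m := S.card / 3 with hm
  obtain ⟨S₁, S₂, S₃, h₁₂, h₁₃, h₂₃, c₁, c₂, c₃, hsub⟩ :=
    exists_three_disjoint_subsets (S := S) (m := m) (by lia)
  have hmk : (m : ℝ) ≤ k := by
    have h1 : S.card ≤ k := (Finset.card_le_univ S).trans (Fintype.card_fin k).le
    exact_mod_cast (Nat.div_le_self _ _).trans h1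
  have hmS : (S.card : ℝ) ≤ 3 * m + 2 := by
    have : S.card ≤ 3 * m + 2 := by lia
    exact_mod_cast this
  have hmα : c₀ / 6 * k ≤ m := by linarith
  set v : ℝ := l / k with hv
  have hv0 : 0 < v := by positivity
  have hv1 : v ≤ 1 := by rwa [hv, div_le_one hk0]
  -- Chosen so that `(2 * ρ) ^ d = l / k`, which is equality in `hball`.
  set ρ : ℝ := v ^ (1 / (d : ℝ)) / 2 with hρ
  have hρ0 : 0 ≤ ρ := by positivity
  have h2ρ : 2 * ρ = v ^ (1 / (d : ℝ)) := by rw [hρ]; ring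
  have hρ1 : 2 * ρ ≤ 1 := by
    rw [h2ρ]
    exact Real.rpow_le_one hv0.le hv1 (by positivity)
  have hρd : (2 * ρ) ^ d = v := by
    rw [h2ρ, one_div]
    exact Real.rpow_inv_natCast_pow hv0.le (by lia)
  have hball : μ * k * (2 * ρ) ^ d ≤ w₀ ^ 2 := by
    rw [hρd, hv, hl]
    refine le_of_eq ?_
    field_simp
  have hekey : β * k ≤ (m : ℝ) ^ 3 * ((2 * ρ) ^ d) ^ 2 * q ^ 3 := by
    calc β * k = (c₀ / 6 * k) ^ 3 * v ^ 2 * q ^ 3 := by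
          rw [hβ, hv]
          field_simp
      _ ≤ (m : ℝ) ^ 3 * ((2 * ρ) ^ d) ^ 2 * q ^ 3 := by
          rw [hρd]
          gcongr
  have hβk : 0 < β * k := by positivity
  have hMf : M ^ 3 * f ≤ (m : ℝ) ^ 3 * ((2 * ρ) ^ d) ^ 2 * q ^ 3 / 2 := by
    have h1 := mul_le_mul_of_nonneg_left hf (by positivity : 0 ≤ M ^ 3)
    have h2 : M ^ 3 * (β / (2 * M ^ 3) * k) = β * k / 2 := by field_simp
    linarith
  refine (altProb_weightedTriangles_lt_le (γ := γ) hk hμ.le hw₀.le hw hρ0 hρ1 hball h₁₂ h₁₃ h₂₃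
    c₁ c₂ c₃ hM (fun a ha => ?_) rfl (hβk.trans_le hekey) hMf).trans ?_
  · have := hsub ha
    simp only [hS, Finset.mem_filter] at this
    exact ⟨this.2.1.le, this.2.2⟩
  -- The numerator uses `m ≤ k`, the denominator `β * k ≤ e`; with `v = l / k` the numerator is
  -- linear in `k`.
  · calc (3 * (m : ℝ) ^ 4 * ((2 * ρ) ^ d) ^ 3 + (m : ℝ) ^ 3 * ((2 * ρ) ^ d) ^ 2) /
          ((m : ℝ) ^ 3 * ((2 * ρ) ^ d) ^ 2 * q ^ 3 / 2) ^ 2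
        ≤ (3 * (k : ℝ) ^ 4 * v ^ 3 + (k : ℝ) ^ 3 * v ^ 2) / (β * k / 2) ^ 2 := by
          rw [hρd] at hekey ⊢
          gcongr
      _ = (3 * l ^ 3 + l ^ 2) / (β / 2) ^ 2 / k := by
          rw [hv]
          field_simp

end GeoCommunity

end

/-! ### Both error probabilities vanish -/

theorem theorem3p1 (d : ℕ) (hd : 1 ≤ d) (γ : ℝ≥0∞) (hγ : 1 < γ)
    (τ C w₀ : ℝ) (hτ : 2 < τ) (hτ' : τ < 3) (hC : 0 < C) (hw₀ : 0 < w₀)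
    (k : ℕ → ℕ) (hk : ∀ n, k n ≤ n)
    (w : (n : ℕ) → Fin n → ℝ) (hw : ∀ n i, 0 < w n i)
    (hw₁ : GeoCommunity.PowerLawWeights τ C w₀ w)
    (hw₂ : GeoCommunity.PowerLawCommunityWeights τ C w₀ k w)
    (hexc : (fun n => GeoCommunity.excessWeight τ (w n)) =O[atTop] (fun n => (n : ℝ)))
    (f : ℕ → ℝ) (hf : Tendsto f atTop atTop)
    (hfk : f =o[atTop] (fun n => (k n : ℝ))) :
    GeoCommunity.AsymptoticallyPowerful d γ (GeoCommunity.meanWeight τ w₀) k w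
      (fun n => GeoCommunity.weightedTriangleTest (w n) (f n)) := by
  have hμ : 0 < GeoCommunity.meanWeight τ w₀ := by
    unfold GeoCommunity.meanWeight
    have h1 : 0 < τ - 1 := by linarith
    have h2 : 0 < τ - 2 := by linarith
    positivity
  set μ := GeoCommunity.meanWeight τ w₀ with hμdef
  -- Eventually `f n ≤ k n`, so the community size diverges along with `f`.
  have hktop : Tendsto (fun n => (k n : ℝ)) atTop atTop := by
    refine tendsto_atTop_mono' _ ?_ hf
    filter_upwards [hfk.bound one_pos] with n hn
    simpa using (le_abs_self _).trans hn
  have hktop' : Tendsto k atTop atTop := tendsto_natCast_atTop_iff.1 hktop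
  obtain ⟨K, hK⟩ := GeoCommunity.exists_sum_weights_le hτ hC hw₀ hw₁ hexc
  have hnull : ∀ᶠ n in atTop, GeoCommunity.nullProb μ (w n)
      {G | f n ≤ GeoCommunity.weightedTriangles (w n) G} ≤ (K / μ) ^ 3 / f n := by
    filter_upwards [hK, hf.eventually_gt_atTop 0, eventually_gt_atTop 0] with n hn hfn hn0
    have hn0' : (0 : ℝ) < n := Nat.cast_pos.2 hn0
    refine (GeoCommunity.nullProb_weightedTriangles_le hμ (hw n) hfn).trans ?_
    refine div_le_div_of_nonneg_right ?_ hfn.le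
    refine pow_le_pow_left₀ (div_nonneg (Finset.sum_nonneg fun i _ => (hw n i).le)
      (by positivity)) ?_ 3
    rw [div_le_div_iff₀ (by positivity) hμ]
    calc (∑ i, w n i) * μ ≤ K * n * μ := by gcongr
      _ = K * (μ * n) := by ring
  have hc₀ : 0 < C * w₀ ^ (1 - τ) / 4 := by positivity
  obtain ⟨ε, hε, D, K', hD⟩ := GeoCommunity.altProb_weightedTriangles_lt_le_div (γ := γ) hd hμ hw₀
    hc₀ (by positivity : 0 < 6 * w₀)
  have halt : ∀ᶠ n in atTop, GeoCommunity.altProb d γ μ (k n) (w n)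
      {G | GeoCommunity.weightedTriangles (w n) G < f n} ≤ D / k n := by
    -- The range constant `A = 1` and relative error `1 / 2` suffice, since the tail is only
    -- evaluated at two fixed levels.
    filter_upwards [hktop.eventually_ge_atTop K', hfk.bound hε, hw₂ 1 one_pos (1 / 2) (by norm_num),
      ((GeoCommunity.tendsto_cutoff (by linarith : 1 < τ)).comp hktop').eventually_ge_atTop
        (6 * w₀)] with n h1 h2 h3 h4
    refine hD n (k n) (hk n) (w n) (f n) (hw n) h1 ?_ ?_
    · simpa using (le_abs_self _).trans h2
    · exact GeoCommunity.card_moderate_weights_ge hτ hC hw₀ (hk n) (by simpa using h4) h3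
  have hlim : Tendsto (fun n => (K / μ) ^ 3 / f n + D / k n) atTop (𝓝 0) := by
    simpa using (hf.const_div_atTop ((K / μ) ^ 3)).add (hktop.const_div_atTop D)
  refine squeeze_zero' (.of_forall fun n => ?_) ?_ hlim
  · refine add_nonneg (Finset.sum_nonneg fun G _ => ?_)
      (integral_nonneg fun x => Finset.sum_nonneg fun G _ => ?_)
    · exact GeoCommunity.graphMass_nonneg (GeoCommunity.irgEdge_nonneg hμ.le (hw n))
        (GeoCommunity.irgEdge_le_one _ _) G
    · exact GeoCommunity.graphMass_nonneg (GeoCommunity.altEdge_nonneg hμ.le (hw n))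
        (GeoCommunity.altEdge_le_one hμ.le (hw n)) G
  · filter_upwards [hnull, halt] with n h1 h2
    have e1 : {G | GeoCommunity.weightedTriangleTest (w n) (f n) G = 1} =
        {G | f n ≤ GeoCommunity.weightedTriangles (w n) G} := by
      ext G
      simp [GeoCommunity.weightedTriangleTest]
    have e2 : {G | GeoCommunity.weightedTriangleTest (w n) (f n) G = 0} =
        {G | GeoCommunity.weightedTriangles (w n) G < f n} := by
      ext G
      simp [GeoCommunity.weightedTriangleTest]
    rw [GeoCommunity.risk, e1, e2]
    exact add_le_add h1 h2
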